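/- **Conventions.** A measured equivalence relation $R$ on $(X,\mu)$ is an equivalence relation with countable classes and Borel graph $R\subset X\times X$ on a standard Borel space $X$ with an atomless Borel probability measure $\mu$, such that the $R$-saturation of every $\mu$-null Borel set is $\mu$-null. "Almost every $(x,y)\in R$" refers to the measure $\mathfrak h(K)=\int_X \#\{y:(x,y)\in K\}\,d\mu(x)$ on $R$. A sequence of Borel subsets (or subrelations with Borel graph) $K_n\subset R$ is increasing if $K_n\subset K_{n+1}$, and exhaustive if $\bigcup_n K_n=R$ up to an $\mathfrak h$-null set. A subrelation is ergodic if every Borel set invariant under it is null or conull. A unitary representation $\pi$ of $R$ on a measurable field $H=(H_x)_{x\in X}$ of separable complex Hilbert spaces is a family of unitary operators $\pi(x,y):H_y\to H_x$, $(x,y)\in R$, with $\pi(x,x)=\mathrm{Id}$, $\pi(x,z)=\pi(x,y)\pi(y,z)$, and measurable coefficients $(x,y)\mapsto\langle \pi(x,y)\xi_y\,|\,\eta_x\rangle$ for all measurable vector fields $\xi,\eta$. It almost has invariant fields if there are measurable fields $\xi^n$ with $\|\xi^n_x\|=1$ for a.e. $x$, an increasing exhaustive sequence $(K_n)$ of Borel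 subsets of $R$, and $\varepsilon_n\to0$ with $\|\pi(x,y)\xi^n_y-\xi^n_x\|\le\varepsilon_n$ for a.e. $(x,y)\in K_n$. The relation $R$ has property T if every unitary representation of $R$ which almost has invariant fields has a measurable field $\xi$ with $\|\xi_x\|=1$ for a.e. $x$ and $\pi(x,y)\xi_y=\xi_x$ for a.e. $(x,y)\in R$. Two measured equivalence relations are stably isomorphic if their restrictions to some Borel sets meeting almost every orbit are isomorphic by a Borel isomorphism preserving the measure classes. A singular space $Q=X/R$ is given by a measured equivalence relation $R$; its discrete desingularizations are the measured equivalence relations stably isomorphic to $R$. The space $Q$ is ergodic if $R$ is; it has property T if all its discrete desingularizations do; it is of finite type if each of its discrete desingularizations is generated, up to a null set, by finitely many partial isomorphisms (Borel isomorphisms between Borel subsets, with graph contained in the relation). **Statement.** Let $R$ be a measured equivalence relation on $(X,\mu)$ with property T, and let $R_0\subset R_1\subset\cdots\subset R$ be an increasing exhaustive sequence of subrelations with Borel graphs. 1. There are an integer $N$ and an $R_N$-invariant Borel set $\Omega\subset X$ with $\mu(\Omega)>0$ on which $R$ and $R_N$ coincide, i.e. $R\cap(\Omega\times\Omega)=R_N\cap(\Omega\times\Omega)$.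 2. If moreover every $R_n$ is ergodic, then there is $N$ such that $R_n=R$ up to an $\mathfrak h$-null set for all $n\ge N$. 3. Every ergodic singular space with property T is of finite type. -/

import Mathlib

open MeasureTheory Filter Topology

universe u

/-- A measured equivalence relation with countable classes on a probability space: a standard
Borel space with an atomless Borel probability measure, and an equivalence relation whose graph
is Borel, whose classes are countable, and for which the saturation of every null Borel set
is null. -/
structure MeasuredRelation where
  carrier : Type u
  [measurableSpace : MeasurableSpace carrier]
  [standardBorel : StandardBorelSpace carrier]
  μ : Measure carrier
  [isProbability : IsProbabilityMeasure μ]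
  [noAtoms : NullSingletonClass μ]
  rel : Setoid carrier
  measurableSet_graph : MeasurableSet {p : carrier × carrier | rel p.1 p.2}
  countable_class : ∀ x, {y | rel x y}.Countable
  quasiInvariant : ∀ A : Set carrier, MeasurableSet A → μ A = 0 → μ {x | ∃ a ∈ A, rel x a} = 0

attribute [instance] MeasuredRelation.measurableSpace MeasuredRelation.standardBorel
  MeasuredRelation.isProbability MeasuredRelation.noAtoms

/-- A measurable field of separable complex Hilbert spaces with base `X`: the fibres, together
with the set of measurable vector fields. -/
structure HilbertField (X : Type u) [MeasurableSpace X] where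
  fiber : X → Type u
  [normed : ∀ x, NormedAddCommGroup (fiber x)]
  [innerProduct : ∀ x, InnerProductSpace ℂ (fiber x)]
  [complete : ∀ x, CompleteSpace (fiber x)]
  /-- the measurable vector fields -/
  sections : Set (∀ x, fiber x)
  measurable_inner : ∀ ξ ∈ sections, ∀ η ∈ sections, Measurable fun x => inner ℂ (ξ x) (η x)
  mem_sections : ∀ η : (∀ x, fiber x),
    (∀ ξ ∈ sections, Measurable fun x => inner ℂ (ξ x) (η x)) → η ∈ sections
  exists_total : ∃ e : ℕ → ∀ x, fiber x, (∀ n, e n ∈ sections) ∧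
    ∀ x, Dense (Submodule.span ℂ (Set.range fun n => e n x) : Set (fiber x))

attribute [instance] HilbertField.normed HilbertField.innerProduct HilbertField.complete

/-- A unitary representation of an equivalence relation on a Hilbert field: unitary operators
`op x y : H_y → H_x` for `x ∼ y`, with `op x x = id`, `op x z = op x y ∘ op y z`, and measurable
coefficients. -/
structure UnitaryRep {X : Type u} [MeasurableSpace X] (R : Setoid X) (H : HilbertField X) where
  op : ∀ x y, R x y → (H.fiber y ≃ₗᵢ[ℂ] H.fiber x)
  op_refl : ∀ x (h : R x x) (v : H.fiber x), op x x h v = v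
  op_comp : ∀ x y z (hxy : R x y) (hyz : R y z) (hxz : R x z) (v : H.fiber z),
    op x z hxz v = op x y hxy (op y z hyz v)
  measurable_coeff : ∀ ξ ∈ H.sections, ∀ η ∈ H.sections,
    Measurable fun p : {p : X × X // R p.1 p.2} =>
      inner ℂ (η p.1.1) (op p.1.1 p.1.2 p.2 (ξ p.1.2))

namespace MeasuredRelation

/-- `P x y` holds for almost every `(x, y) ∈ R`, with respect to the measure
`𝔥(K) = ∫ #{y | (x, y) ∈ K} dμ(x)` on the graph of `R`: the exceptional set has empty
horizontal fibre over almost every `x`. -/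
def AEPair (R : MeasuredRelation.{u}) (P : ∀ x y, R.rel x y → Prop) : Prop :=
  ∀ᵐ x ∂(R.μ), ∀ y (h : R.rel x y), P x y h

/-- An increasing exhaustive sequence of Borel subsets of (the graph of) `R`. -/
structure IsExhaustion (R : MeasuredRelation.{u}) (K : ℕ → Set (R.carrier × R.carrier)) :
    Prop where
  measurableSet : ∀ n, MeasurableSet (K n)
  subset : ∀ n, ∀ p ∈ K n, R.rel p.1 p.2
  mono : Monotone K
  exhaustive : R.AEPair fun x y _ => ∃ n, (x, y) ∈ K n

/-- The vector field `ξ` is `(K, ε)`-invariant: `‖π(x,y) ξ_y - ξ_x‖ ≤ ε` for almost every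
`(x, y) ∈ K`. -/
def IsAlmostInvariant (R : MeasuredRelation.{u}) {H : HilbertField R.carrier}
    (π : UnitaryRep R.rel H) (K : Set (R.carrier × R.carrier)) (ε : ℝ)
    (ξ : ∀ x, H.fiber x) : Prop :=
  R.AEPair fun x y h => (x, y) ∈ K → ‖π.op x y h (ξ y) - ξ x‖ ≤ ε

/-- Measurable vector fields of norm one almost everywhere. -/
def IsUnitField (R : MeasuredRelation.{u}) (H : HilbertField R.carrier)
    (ξ : ∀ x, H.fiber x) : Prop :=
  ξ ∈ H.sections ∧ ∀ᵐ x ∂(R.μ), ‖ξ x‖ = 1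

/-- `π` almost has invariant fields: there is an almost invariant sequence of unit fields. -/
def HasAlmostInvariantFields (R : MeasuredRelation.{u}) {H : HilbertField R.carrier}
    (π : UnitaryRep R.rel H) : Prop :=
  ∃ (ξ : ℕ → ∀ x, H.fiber x) (K : ℕ → Set (R.carrier × R.carrier)) (ε : ℕ → ℝ),
    (∀ n, R.IsUnitField H (ξ n)) ∧ R.IsExhaustion K ∧ Tendsto ε atTop (𝓝 0) ∧
      ∀ n, R.IsAlmostInvariant π (K n) (ε n) (ξ n)

/-- Kazhdan's property T for a measured equivalence relation. -/
def PropertyT (R : MeasuredRelation.{u}) : Prop :=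
  ∀ (H : HilbertField R.carrier) (π : UnitaryRep R.rel H), R.HasAlmostInvariantFields π →
    ∃ ξ : ∀ x, H.fiber x, R.IsUnitField H ξ ∧ R.AEPair fun x y h => π.op x y h (ξ y) = ξ x

/-- `A` is invariant under the equivalence relation `S`. -/
def IsInvariantSet {X : Type u} (S : Setoid X) (A : Set X) : Prop :=
  ∀ x y, S x y → x ∈ A → y ∈ A

/-- The (sub)relation `S` is ergodic for the measure of `R`. -/
def IsErgodicFor (R : MeasuredRelation.{u}) (S : Setoid R.carrier) : Prop :=
  ∀ A : Set R.carrier, MeasurableSet A → IsInvariantSet S A → R.μ A = 0 ∨ R.μ Aᶜ = 0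

/-- An increasing exhaustive sequence of (Borel) subrelations of `R`. -/
structure IsApproximation (R : MeasuredRelation.{u}) (S : ℕ → Setoid R.carrier) : Prop where
  measurableSet_graph : ∀ n, MeasurableSet {p : R.carrier × R.carrier | S n p.1 p.2}
  le : ∀ n, S n ≤ R.rel
  mono : Monotone S
  exhaustive : R.AEPair fun x y _ => ∃ n, S n x y

/-- A partial isomorphism of `R`: a Borel isomorphism between two Borel subsets whose graph is
contained in `R`. -/
structure PartialIso (R : MeasuredRelation.{u}) where
  source : Set R.carrier
  target : Set R.carrier
  measurableSet_source : MeasurableSet source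
  measurableSet_target : MeasurableSet target
  toEquiv : source ≃ᵐ target
  rel_apply : ∀ a : source, R.rel a (toEquiv a)

/-- `R` is, up to a null set, generated by finitely many partial isomorphisms. -/
def FinitelyGenerated (R : MeasuredRelation.{u}) : Prop :=
  ∃ (k : ℕ) (φ : Fin k → R.PartialIso),
    R.AEPair fun x y _ =>
      Relation.EqvGen (fun a b => ∃ i, ∃ h : a ∈ (φ i).source, ((φ i).toEquiv ⟨a, h⟩ : R.carrier) = b)
        x y

/-- Stable isomorphism: the restrictions of the two relations to Borel sets meeting almost every
orbit are isomorphic, by a Borel isomorphism which preserves the measure classes. -/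
def StablyIsomorphic (R S : MeasuredRelation.{u}) : Prop :=
  ∃ (Y : Set R.carrier) (Z : Set S.carrier) (f : Y ≃ᵐ Z),
    MeasurableSet Y ∧ MeasurableSet Z ∧
    (∀ᵐ x ∂(R.μ), ∃ y ∈ Y, R.rel x y) ∧ (∀ᵐ x ∂(S.μ), ∃ z ∈ Z, S.rel x z) ∧
    (∀ A : Set Y, MeasurableSet A →
      (R.μ (Subtype.val '' A) = 0 ↔ S.μ (Subtype.val '' (f '' A)) = 0)) ∧
    ∀ a b : Y, R.rel a b ↔ S.rel (f a) (f b)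

/-! A singular space `Q` is given by a measured equivalence relation `R` with `Q = X/R`; its
discrete desingularizations are the measured equivalence relations stably isomorphic to `R`. -/

/-- `S` is a discrete desingularization of the singular space `X/R`. -/
def IsDesingularization (R S : MeasuredRelation.{u}) : Prop := R.StablyIsomorphic S

/-- The singular space `X/R` is ergodic. -/
def SingularErgodic (R : MeasuredRelation.{u}) : Prop := R.IsErgodicFor R.rel

/-- The singular space `X/R` has property T: all its discrete desingularizations do. -/
def SingularPropertyT (R : MeasuredRelation.{u}) : Prop :=
  ∀ S : MeasuredRelation.{u}, R.IsDesingularization S → S.PropertyT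

/-- The singular space `X/R` is of finite type: all its discrete desingularizations are generated
by finitely many partial isomorphisms. -/
def SingularFiniteType (R : MeasuredRelation.{u}) : Prop :=
  ∀ S : MeasuredRelation.{u}, R.IsDesingularization S → S.FinitelyGenerated

end MeasuredRelation

/-! To each point `x` attach the ℓ² space of functions on the set of all `S n`-classes, over all
`n`, contained in the `R`-class of `x`. This space depends only on the `R`-class, so `R` acts on the
field by identity maps. The unit vector at the `S n`-class of `x` is a field exactly invariant under
`S n`; as the `S n` exhaust `R`, these fields are almost invariant. Property T then gives a unit
field `ξ` that is constant along almost every `R`-class.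

For some `n` and some threshold, the set `A` of points `x` at which `ξ x` exceeds the threshold on
the `S n`-class of `x` has positive measure. Square summability leaves only finitely many such `S
n`-classes in each `R`-class, and a later relation `S m` joins `x` to all of them. A single `m`
works on a subset of `A` of positive measure, and on its `S m`-saturation `R` and `S m` coincide
(`PropertyT.exists_coincide`). If `S m` is ergodic this saturation is conull.

For finite type, the approximation consists of the relations generated by the first `n` involutions
of a Feldman–Moore cover. One of them agrees with `R` on a set `Ω` of positive measure, whose
`R`-saturation is conull by ergodicity. One more partial isomorphism connects almost every point to
`Ω` (`IsInvolutiveCover.exists_injOn_eqvGen`). Ergodicity passes to every desingularization, where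
the same argument applies.

The Feldman–Moore cover rests on a Lusin–Novikov theorem modulo null sets, itself deduced from the
measurability of analytic sets. -/

/-! ### Universal measurability of analytic sets -/

theorem isCompact_setOf_forall_le (k : ℕ → ℕ) : IsCompact {s : ℕ → ℕ | ∀ i, s i ≤ k i} := by
  have : {s : ℕ → ℕ | ∀ i, s i ≤ k i} = Set.univ.pi fun i => Set.Iic (k i) := by
    ext t; simp [Pi.le_def]
  rw [this]
  exact isCompact_univ_pi fun i => (Set.finite_Iic (k i)).isCompact

/-- An open subset of Baire space containing a product of initial segments `{i | i ≤ k n}`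
contains one of the cylinders obtained by keeping finitely many of the constraints. -/
theorem exists_bounded_cylinder_subset_of_isOpen {k : ℕ → ℕ} {O : Set (ℕ → ℕ)} (hO : IsOpen O)
    (h : {s : ℕ → ℕ | ∀ i, s i ≤ k i} ⊆ O) : ∃ m, {s : ℕ → ℕ | ∀ i < m, s i ≤ k i} ⊆ O := by
  by_contra! hcon
  have hcon' : ∀ m, ∃ s : ℕ → ℕ, (∀ i < m, s i ≤ k i) ∧ s ∉ O := fun m => by
    obtain ⟨s, hs, hsO⟩ := Set.not_subset.1 (hcon m)
    exact ⟨s, hs, hsO⟩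
  choose s hs hsO using hcon'
  -- Only the first `m` coordinates of `s m` are bounded, so truncation brings the sequence into the
  -- compact box. Each coordinate is eventually unaffected, hence the limit is the same.
  obtain ⟨t, ht, φ, hφ, hlim⟩ := (isCompact_setOf_forall_le k).tendsto_subseq (x := fun m i => min (s m i) (k i))
    (fun m i => min_le_right _ _)
  have hlim' : Tendsto (fun m => s (φ m)) atTop (𝓝 t) := by
    rw [tendsto_pi_nhds] at hlim ⊢
    intro i
    refine (hlim i).congr' ?_
    filter_upwards [eventually_gt_atTop i] with m hm
    exact min_eq_left (hs (φ m) i (hm.trans_le (hφ.id_le m)))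
  exact hO.isClosed_compl.mem_of_tendsto hlim' (Eventually.of_forall fun m => hsO (φ m)) (h ht)

/-- The range of a continuous function on Baire space is approximated from inside by compact
sets, in the sense of outer measure. -/
theorem exists_isCompact_subset_range_le_measure {X : Type*} [TopologicalSpace X]
    [MeasurableSpace X] (μ : Measure X) [μ.OuterRegular] {f : (ℕ → ℕ) → X} (hf : Continuous f)
    {c : ENNReal} (hc : c < μ (Set.range f)) :
    ∃ K, IsCompact K ∧ K ⊆ Set.range f ∧ c ≤ μ K := by
  -- Continuity from below along increasing unions holds for arbitrary sets, so one more coordinate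
  -- can be bounded while the outer measure of the image stays above `c`.
  have step : ∀ (m : ℕ) (T : {T : Set (ℕ → ℕ) // c < μ (f '' T)}),
      ∃ k, c < μ (f '' (T.1 ∩ {s | s m ≤ k})) := by
    rintro m ⟨T, hT⟩
    have hU : f '' T = ⋃ k : ℕ, f '' (T ∩ {s | s m ≤ k}) := by
      rw [← Set.image_iUnion, ← Set.inter_iUnion]
      congr 1
      refine (Set.inter_eq_left.2 fun s _ => ?_).symm
      exact Set.mem_iUnion.2 ⟨s m, le_refl (s m)⟩
    have hmono : Monotone fun k : ℕ => f '' (T ∩ {s | s m ≤ k}) := fun a b hab =>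
      Set.image_mono (Set.inter_subset_inter_right _ fun s (hs : s m ≤ a) => hs.trans hab)
    rw [hU, hmono.measure_iUnion] at hT
    exact lt_iSup_iff.1 hT
  choose k hk using step
  let T : ℕ → {T : Set (ℕ → ℕ) // c < μ (f '' T)} := fun n =>
    Nat.rec ⟨Set.univ, by rwa [Set.image_univ]⟩ (fun m T => ⟨_, hk m T⟩) n
  have hT : ∀ m, (T m).1 = {s | ∀ i < m, s i ≤ k i (T i)} := by
    intro m
    induction m with
    | zero => ext s; simp [T]
    | succ m ih =>
      have : (T (m + 1)).1 = (T m).1 ∩ {s | s m ≤ k m (T m)} := rfl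
      rw [this, ih]
      ext s
      simp only [Set.mem_inter_iff, Set.mem_ofPred_eq, Nat.forall_lt_succ_right]
  refine ⟨_, (isCompact_setOf_forall_le fun i => k i (T i)).image hf, Set.image_subset_range _ _, ?_⟩
  -- An open set containing the compact image already contains the image of some cylinder `T m`,
  -- whose outer measure exceeds `c`.
  rw [Set.measure_eq_iInf_isOpen]
  refine le_iInf fun V => le_iInf fun hV => le_iInf fun hVo => ?_
  obtain ⟨m, hm⟩ := exists_bounded_cylinder_subset_of_isOpen (hVo.preimage hf)
    (Set.image_subset_iff.1 hV)
  rw [← hT m] at hm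
  exact (T m).2.le.trans (measure_mono (Set.image_subset_iff.2 hm))

/-- Analytic subsets of a Polish space are measurable for the completion of every finite Borel
measure. -/
theorem MeasureTheory.AnalyticSet.nullMeasurableSet {X : Type*} [TopologicalSpace X]
    [PolishSpace X] [MeasurableSpace X] [BorelSpace X] {A : Set X} (hA : AnalyticSet A)
    (μ : Measure X) [IsFiniteMeasure μ] : NullMeasurableSet A μ := by
  rw [AnalyticSet] at hA
  obtain rfl | ⟨f, hf, rfl⟩ := hA
  · exact MeasurableSet.empty.nullMeasurableSet
  by_cases h0 : μ (Set.range f) = 0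
  · exact NullMeasurableSet.of_null h0
  obtain ⟨c, -, hc, hlim⟩ := exists_seq_strictMono_tendsto' (pos_iff_ne_zero.2 h0)
  choose K hKc hKf hK using fun n => exists_isCompact_subset_range_le_measure μ hf (hc n).2
  have hKm : MeasurableSet (⋃ n, K n) := MeasurableSet.iUnion fun n => (hKc n).measurableSet
  have hsub : (⋃ n, K n) ⊆ Set.range f := Set.iUnion_subset hKf
  have hle : μ (Set.range f) ≤ μ (⋃ n, K n) :=
    le_of_tendsto' hlim fun n => (hK n).trans (measure_mono (Set.subset_iUnion K n))
  have : (⋃ n, K n) =ᵐ[μ] Set.range f :=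
    ae_eq_of_subset_of_measure_ge hsub hle hKm.nullMeasurableSet (measure_ne_top _ _)
  exact hKm.nullMeasurableSet.congr this

/-! ### Lusin–Novikov uniformization modulo null sets -/

theorem exists_nat_open_basis (P : Type*) [TopologicalSpace P] [SecondCountableTopology P] :
    ∃ U : ℕ → Set P, (∀ n, IsOpen (U n)) ∧
      ∀ (q : P) (O : Set P), IsOpen O → q ∈ O → ∃ n, q ∈ U n ∧ U n ⊆ O := by
  have hB := TopologicalSpace.isBasis_countableBasis P
  obtain hP | hP := isEmpty_or_nonempty P
  · exact ⟨fun _ => ∅, fun _ => isOpen_empty, fun q => (hP.false q).elim⟩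
  obtain ⟨q₀⟩ := hP
  obtain ⟨V, hV, -, -⟩ := hB.exists_subset_of_mem_open (Set.mem_univ q₀) isOpen_univ
  obtain ⟨U, hU⟩ := (TopologicalSpace.countable_countableBasis P).exists_eq_range ⟨V, hV⟩
  refine ⟨U, fun n => hB.isOpen (hU ▸ Set.mem_range_self n), fun q O hO hq => ?_⟩
  obtain ⟨W, hW, hqW, hWO⟩ := hB.exists_subset_of_mem_open hq hO
  rw [hU] at hW
  obtain ⟨n, rfl⟩ := hW
  exact ⟨n, hqW, hWO⟩

/-- A nonempty countable closed subset of a Polish space has an isolated point. -/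
theorem IsClosed.exists_isolated_of_countable {P : Type*} [TopologicalSpace P] [PolishSpace P]
    {C : Set P} (hC : IsClosed C) (hcount : C.Countable) (hne : C.Nonempty) :
    ∃ q ∈ C, ∃ O, IsOpen O ∧ q ∈ O ∧ O ∩ C ⊆ {q} := by
  by_contra! hcon
  have hperf : Perfect C := by
    refine ⟨hC, preperfect_iff_nhds.2 fun q hq V hV => ?_⟩
    obtain ⟨O, hOV, hO, hqO⟩ := mem_nhds_iff.1 hV
    obtain ⟨y, hy, hyq⟩ := Set.not_subset.1 (hcon q hq O hO hqO)
    exact ⟨y, ⟨hOV hy.1, hy.2⟩, hyq⟩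
  let := TopologicalSpace.upgradeIsCompletelyMetrizable P
  obtain ⟨f, hfC, -, hf⟩ := hperf.exists_nat_bool_injection hne
  have h0 : Cardinal.aleph0 < Cardinal.mk (ℕ → Bool) := by
    simpa using Cardinal.cantor Cardinal.aleph0
  have h1 : (Set.range f).Countable := hcount.mono hfC
  have h2 : Countable (ℕ → Bool) := by
    have := h1.to_subtype
    exact (Set.rangeFactorization_injective.2 hf).countable
  exact (Cardinal.mk_le_aleph0_iff.2 h2).not_gt h0

/-- The complement of `C` is covered, over almost every point, by countably many measurable sets
on which `p` is injective; moreover `C` is measurable with closed intersections with the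
fibres of `p`. -/
structure IsCoverRemainder {P X : Type*} [MeasurableSpace P] [TopologicalSpace P]
    [MeasurableSpace X] (μ : Measure X) (p : P → X) (C : Set P) : Prop where
  measurableSet : MeasurableSet C
  isClosed_fiber : ∀ x, IsClosed (C ∩ p ⁻¹' {x})
  exists_cover : ∃ G : ℕ → Set P, (∀ n, MeasurableSet (G n)) ∧ (∀ n, Set.InjOn p (G n)) ∧
    ∀ᵐ x ∂μ, p ⁻¹' {x} ⊆ C ∪ ⋃ n, G n

namespace IsCoverRemainder

variable {P X : Type*} [MeasurableSpace P] [TopologicalSpace P] [MeasurableSpace X]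
  {μ : Measure X} {p : P → X}

theorem univ (hp : ∀ x, IsClosed (p ⁻¹' {x})) : IsCoverRemainder μ p Set.univ :=
  ⟨MeasurableSet.univ, fun x => by simpa using hp x, fun _ => ∅, fun _ => MeasurableSet.empty,
    fun _ => Set.injOn_empty _, by simp⟩

theorem iInter {ι : Type*} [Countable ι] {C : ι → Set P} [Nonempty ι]
    (hC : ∀ k, IsCoverRemainder μ p (C k)) : IsCoverRemainder μ p (⋂ k, C k) := by
  choose G hGm hGi hG using fun k => (hC k).exists_cover
  obtain ⟨e, he⟩ := exists_surjective_nat (ι × ℕ)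
  refine ⟨MeasurableSet.iInter fun k => (hC k).measurableSet, fun x => ?_,
    fun n => G (e n).1 (e n).2, fun n => hGm _ _, fun n => hGi _ _, ?_⟩
  · rw [Set.iInter_inter]
    exact isClosed_iInter fun k => (hC k).isClosed_fiber x
  · filter_upwards [ae_all_iff.2 hG] with x hx q hq
    by_cases h : ∃ k n, q ∈ G k n
    · obtain ⟨k, n, hkn⟩ := h
      obtain ⟨m, hm⟩ := he (k, n)
      exact Or.inr (Set.mem_iUnion.2 ⟨m, by rwa [hm]⟩)
    · push Not at h
      refine Or.inl (Set.mem_iInter.2 fun k => ?_)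
      refine (hx k hq).resolve_right fun hq' => ?_
      obtain ⟨n, hn⟩ := Set.mem_iUnion.1 hq'
      exact h k n hn

/-- Since `D n` is a union of fibres of `p`, what is removed from a fibre is relatively open in it,
so the remaining fibre is closed. The removed pieces of `C` join the injective cover. -/
theorem diff {C : Set P} (hC : IsCoverRemainder μ p C) {U D : ℕ → Set P}
    (hU : ∀ n, IsOpen (U n)) (hUm : ∀ n, MeasurableSet (D n ∩ U n))
    (hD : ∀ n, ∀ q q', p q = p q' → q ∈ D n → q' ∈ D n)
    (hinj : ∀ n, Set.InjOn p (C ∩ (D n ∩ U n))) :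
    IsCoverRemainder μ p (C \ ⋃ n, D n ∩ U n) := by
  obtain ⟨G, hGm, hGi, hG⟩ := hC.exists_cover
  refine ⟨hC.measurableSet.diff (MeasurableSet.iUnion hUm), fun x => ?_, ?_⟩
  · have : (C \ ⋃ n, D n ∩ U n) ∩ p ⁻¹' {x} =
        (C ∩ p ⁻¹' {x}) ∩ (⋃ n, ⋃ _ : ∃ q ∈ D n, p q = x, U n)ᶜ := by
      ext q
      simp only [Set.mem_inter_iff, Set.mem_sdiff, Set.mem_iUnion, Set.mem_preimage,
        Set.mem_singleton_iff, Set.mem_compl_iff, exists_prop, not_exists, not_and]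
      constructor
      · rintro ⟨⟨h1, h2⟩, h3⟩
        refine ⟨⟨h1, h3⟩, fun n ⟨q', hq', hx⟩ => h2 n (hD n q' q (hx.trans h3.symm) hq')⟩
      · rintro ⟨⟨h1, h3⟩, h2⟩
        exact ⟨⟨h1, fun n hn => h2 n ⟨q, hn, h3⟩⟩, h3⟩
    rw [this]
    exact (hC.isClosed_fiber x).inter
      (isOpen_iUnion fun n => isOpen_iUnion fun _ => hU n).isClosed_compl
  · obtain ⟨e, he⟩ := exists_surjective_nat (ℕ ⊕ ℕ)
    let G' : ℕ ⊕ ℕ → Set P := Sum.elim G fun n => C ∩ (D n ∩ U n)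
    have hG'm : ∀ k, MeasurableSet (G' k) := by
      rintro (n | n)
      exacts [hGm n, hC.measurableSet.inter (hUm n)]
    have hG'i : ∀ k, Set.InjOn p (G' k) := by
      rintro (n | n)
      exacts [hGi n, hinj n]
    refine ⟨fun n => G' (e n), fun n => hG'm _, fun n => hG'i _, ?_⟩
    filter_upwards [hG] with x hx q hq
    have hcov : ∀ k, q ∈ G' k → q ∈ ⋃ n, G' (e n) := fun k hk => by
      obtain ⟨n, hn⟩ := he k
      exact Set.mem_iUnion.2 ⟨n, by rwa [hn]⟩
    rcases hx hq with h | h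
    · by_cases hq' : q ∈ ⋃ n, D n ∩ U n
      · obtain ⟨n, hn⟩ := Set.mem_iUnion.1 hq'
        exact Or.inr (hcov (Sum.inr n) ⟨h, hn⟩)
      · exact Or.inl ⟨h, hq'⟩
    · obtain ⟨n, hn⟩ := Set.mem_iUnion.1 h
      exact Or.inr (hcov (Sum.inl n) hn)

end IsCoverRemainder

/-- A remainder whose images of basic open sets have minimal outer measure. -/
theorem exists_isCoverRemainder_minimal {P X : Type*} [MeasurableSpace P] [TopologicalSpace P]
    [MeasurableSpace X] (μ : Measure X) {p : P → X} (hp : ∀ x, IsClosed (p ⁻¹' {x}))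
    (U : ℕ → Set P) :
    ∃ C, IsCoverRemainder μ p C ∧ ∀ C', IsCoverRemainder μ p C' → ∀ n,
      μ (p '' (U n ∩ C)) ≤ μ (p '' (U n ∩ C')) := by
  have key : ∀ n, ∃ C, IsCoverRemainder μ p C ∧ ∀ C', IsCoverRemainder μ p C' →
      μ (p '' (U n ∩ C)) ≤ μ (p '' (U n ∩ C')) := by
    intro n
    let S : Set ENNReal := (fun C => μ (p '' (U n ∩ C))) '' {C | IsCoverRemainder μ p C}
    have hS : S.Nonempty := ⟨_, Set.univ, IsCoverRemainder.univ hp, rfl⟩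
    obtain ⟨u, -, hlim, hu⟩ := exists_seq_tendsto_sInf hS (OrderBot.bddBelow S)
    choose C hC hCu using hu
    refine ⟨⋂ k, C k, IsCoverRemainder.iInter hC, fun C' hC' => ?_⟩
    refine le_trans (ge_of_tendsto' hlim fun k => ?_) (csInf_le (OrderBot.bddBelow S) ⟨C', hC', rfl⟩)
    rw [← hCu k]
    exact measure_mono (Set.image_mono (Set.inter_subset_inter_right _ (Set.iInter_subset C k)))
  choose C hC hmin using key
  refine ⟨⋂ n, C n, IsCoverRemainder.iInter hC, fun C' hC' n => ?_⟩
  exact le_trans (measure_mono (Set.image_mono (Set.inter_subset_inter_right _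
    (Set.iInter_subset C n)))) (hmin n C' hC')

section Polish

variable {P X : Type*} [MeasurableSpace P] [TopologicalSpace P] [PolishSpace P] [BorelSpace P]
  [MeasurableSpace X] [StandardBorelSpace X] {p : P → X}

theorem nullMeasurableSet_image_of_measurable (μ : Measure X) [IsFiniteMeasure μ]
    (hp : Measurable p) {s : Set P} (hs : MeasurableSet s) : NullMeasurableSet (p '' s) μ := by
  let := upgradeStandardBorel X
  exact (hs.analyticSet_image hp).nullMeasurableSet μ

/-- The set of points having exactly one preimage in a given measurable set is measurable for the
completion of every finite measure. -/
theorem nullMeasurableSet_existsUnique (μ : Measure X) [IsFiniteMeasure μ]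
    (hp : Measurable p) {s : Set P} (hs : MeasurableSet s) :
    NullMeasurableSet {x | ∃! q, q ∈ s ∧ p q = x} μ := by
  obtain ⟨U, hU, hbasis⟩ := exists_nat_open_basis P
  -- Two distinct preimages are separated by disjoint basic open sets, so non-uniqueness is a
  -- countable union of intersections of analytic sets.
  have : {x | ∃! q, q ∈ s ∧ p q = x} =
      p '' s \ ⋃ k : {k : ℕ × ℕ // Disjoint (U k.1) (U k.2)},
        p '' (s ∩ U k.1.1) ∩ p '' (s ∩ U k.1.2) := by
    ext x
    simp only [Set.mem_ofPred_eq, Set.mem_sdiff, Set.mem_iUnion, not_exists]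
    constructor
    · rintro ⟨q, ⟨hq, hqx⟩, huniq⟩
      refine ⟨⟨q, hq, hqx⟩, ?_⟩
      rintro ⟨k, hk⟩ ⟨⟨q₁, ⟨h1, h1U⟩, h1x⟩, ⟨q₂, ⟨h2, h2U⟩, h2x⟩⟩
      have e1 := huniq q₁ ⟨h1, h1x⟩
      have e2 := huniq q₂ ⟨h2, h2x⟩
      exact Set.disjoint_left.1 hk h1U (e1.trans e2.symm ▸ h2U)
    · rintro ⟨⟨q, hq, hqx⟩, h⟩
      refine ⟨q, ⟨hq, hqx⟩, fun q' ⟨hq', hqx'⟩ => ?_⟩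
      by_contra hne
      obtain ⟨V, W, hV, hW, hqV, hqW, hVW⟩ := t2_separation hne
      obtain ⟨m, hm, hmV⟩ := hbasis _ _ hV hqV
      obtain ⟨n, hn, hnW⟩ := hbasis _ _ hW hqW
      exact h ⟨(m, n), hVW.mono hmV hnW⟩ ⟨⟨q', ⟨hq', hm⟩, hqx'⟩, ⟨q, ⟨hq, hn⟩, hqx⟩⟩
  rw [this]
  refine (nullMeasurableSet_image_of_measurable μ hp hs).diff (NullMeasurableSet.iUnion fun k => ?_)
  exact (nullMeasurableSet_image_of_measurable μ hp (hs.inter (hU _).measurableSet)).inter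
    (nullMeasurableSet_image_of_measurable μ hp (hs.inter (hU _).measurableSet))

/-- Take a minimal remainder `C`, and let `E n` be, up to a null set, the points with a unique
preimage in `U n ∩ C`. That part of `C` may be moved to the cover; by minimality this changes the
image of `U n ∩ C` by a null set only, although it removes every point of `E n` from the image. So
almost no fibre of `C` has an isolated point, whereas a nonempty countable closed set must have one.
-/
theorem exists_countable_injOn_cover_of_isClosed_fiber (μ : Measure X) [IsFiniteMeasure μ]
    (hp : Measurable p) (hcl : ∀ x, IsClosed (p ⁻¹' {x})) (hcount : ∀ x, (p ⁻¹' {x}).Countable) :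
    ∃ G : ℕ → Set P, (∀ n, MeasurableSet (G n)) ∧ (∀ n, Set.InjOn p (G n)) ∧
      ∀ᵐ x ∂μ, p ⁻¹' {x} ⊆ ⋃ n, G n := by
  obtain ⟨U, hU, hbasis⟩ := exists_nat_open_basis P
  obtain ⟨C, hC, hmin⟩ := exists_isCoverRemainder_minimal μ hcl U
  have hUC : ∀ n, MeasurableSet (U n ∩ C) := fun n => (hU n).measurableSet.inter hC.measurableSet
  choose E hEsub hEm hEae using fun n =>
    (nullMeasurableSet_existsUnique μ hp (hUC n)).exists_measurable_subset_ae_eq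
  have hC' : IsCoverRemainder μ p (C \ ⋃ n, p ⁻¹' E n ∩ U n) := by
    refine hC.diff hU (fun n => (hp (hEm n)).inter (hU n).measurableSet)
      (fun n q q' h hq => by simpa [← h] using hq) fun n q hq q' hq' h => ?_
    exact (hEsub n hq.2.1).unique ⟨⟨hq.2.2, hq.1⟩, rfl⟩ ⟨⟨hq'.2.2, hq'.1⟩, h.symm⟩
  set C' := C \ ⋃ n, p ⁻¹' E n ∩ U n with hC'def
  have himage : ∀ n, p '' (U n ∩ C') =ᵐ[μ] p '' (U n ∩ C) := fun n =>
    ae_eq_of_subset_of_measure_ge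
      (Set.image_mono (Set.inter_subset_inter_right _ Set.sdiff_subset)) (hmin C' hC' n)
      (nullMeasurableSet_image_of_measurable μ hp
        ((hU n).measurableSet.inter hC'.measurableSet)) (measure_ne_top _ _)
  obtain ⟨G, hGm, hGi, hG⟩ := hC.exists_cover
  refine ⟨G, hGm, hGi, ?_⟩
  filter_upwards [hG, ae_all_iff.2 fun n => (himage n).mem_iff,
    ae_all_iff.2 fun n => (hEae n).mem_iff] with x hx himx hEx
  have hempty : C ∩ p ⁻¹' {x} = ∅ := by
    by_contra hne
    obtain ⟨q, hq, O, hO, hqO, hOq⟩ := (hC.isClosed_fiber x).exists_isolated_of_countable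
      ((hcount x).mono Set.inter_subset_right) (Set.nonempty_iff_ne_empty.2 hne)
    obtain ⟨n, hn, hnO⟩ := hbasis q O hO hqO
    have huniq : ∃! q', q' ∈ U n ∩ C ∧ p q' = x :=
      ⟨q, ⟨⟨hn, hq.1⟩, hq.2⟩, fun q' hq' => hOq ⟨hnO hq'.1.1, hq'.1.2, hq'.2⟩⟩
    have hxE : x ∈ E n := (hEx n).2 huniq
    obtain ⟨q', ⟨hq'U, hq'C⟩, hq'x⟩ := (himx n).2 ⟨q, ⟨hn, hq.1⟩, hq.2⟩
    refine hq'C.2 (Set.mem_iUnion.2 ⟨n, ?_, hq'U⟩)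
    change p q' ∈ E n
    rwa [hq'x]
  intro q hq
  refine (hx hq).resolve_left fun hqC => ?_
  exact (hempty ▸ (⟨hqC, hq⟩ : q ∈ C ∩ p ⁻¹' {x}) : q ∈ (∅ : Set P))

end Polish

/-- **Lusin–Novikov uniformization**, up to a null set: if a measurable map between standard Borel
spaces has countable fibres, then over almost every point the fibre is covered by a fixed countable
family of measurable sets on which the map is injective. -/
theorem exists_countable_injOn_cover {P X : Type*} [MeasurableSpace P] [StandardBorelSpace P]
    [MeasurableSpace X] [StandardBorelSpace X] (μ : Measure X) [IsFiniteMeasure μ] {p : P → X}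
    (hp : Measurable p) (hcount : ∀ x, (p ⁻¹' {x}).Countable) :
    ∃ G : ℕ → Set P, (∀ n, MeasurableSet (G n)) ∧ (∀ n, Set.InjOn p (G n)) ∧
      ∀ᵐ x ∂μ, p ⁻¹' {x} ⊆ ⋃ n, G n := by
  let := upgradeStandardBorel X
  let tP := upgradeStandardBorel P
  -- A finer Polish topology with the same Borel sets makes `p` continuous, hence its fibres closed.
  obtain ⟨t', hle, hcont, hpol⟩ := hp.exists_continuous
  have hborel : @BorelSpace P t' _ := by
    refine @BorelSpace.mk _ t' _ ?_
    rw [@borel_eq_borel_of_le P t' tP.toTopologicalSpace hpol inferInstance hle]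
    exact eq_borel_upgradeStandardBorel P
  exact @exists_countable_injOn_cover_of_isClosed_fiber P X _ t' hpol hborel _ _ p μ _ hp
    (fun x => (isClosed_singleton (x := x)).preimage hcont) hcount

/-! ### Feldman–Moore: covering the relation by involutions -/

/-- A measurable symmetric partial function, given by its graph, extends to a measurable
involution equal to the identity off its domain. -/
theorem exists_measurable_involution_of_graph {X : Type*} [MeasurableSpace X]
    [StandardBorelSpace X] {Δ : Set (X × X)} (hm : MeasurableSet Δ)
    (hsymm : ∀ x y, (x, y) ∈ Δ → (y, x) ∈ Δ) (hfun : ∀ x y z, (x, y) ∈ Δ → (x, z) ∈ Δ → y = z) :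
    ∃ σ : X → X, Measurable σ ∧ (∀ x, σ (σ x) = x) ∧ (∀ x y, (x, y) ∈ Δ → σ x = y) ∧
      ∀ x, σ x = x ∨ (x, σ x) ∈ Δ := by
  classical
  let σ : X → X := fun x => if h : ∃ y, (x, y) ∈ Δ then h.choose else x
  have hσ : ∀ x y, (x, y) ∈ Δ → σ x = y := fun x y h => by
    have h' : ∃ y, (x, y) ∈ Δ := ⟨y, h⟩
    simp only [σ, dif_pos h']
    exact hfun _ _ _ h'.choose_spec h
  have hσ' : ∀ x, (¬ ∃ y, (x, y) ∈ Δ) → σ x = x := fun x h => by simp only [σ, dif_neg h]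
  have hinj : Set.InjOn (Prod.fst : X × X → X) Δ := by
    rintro ⟨x, y⟩ h ⟨x', y'⟩ h' (rfl : x = x')
    rw [hfun _ _ _ h h']
  refine ⟨σ, fun B hB => ?_, fun x => ?_, hσ, fun x => ?_⟩
  · have : σ ⁻¹' B = Prod.fst '' (Δ ∩ Prod.snd ⁻¹' B) ∪ B \ Prod.fst '' Δ := by
      ext x
      simp only [Set.mem_preimage, Set.mem_union, Set.mem_image, Set.mem_inter_iff, Prod.exists,
        exists_and_right, exists_eq_right, Set.mem_sdiff]
      by_cases h : ∃ y, (x, y) ∈ Δ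
      · obtain ⟨y, hy⟩ := h
        rw [hσ x y hy]
        constructor
        · exact fun hyB => Or.inl ⟨y, hy, hyB⟩
        · rintro (⟨z, hz, hzB⟩ | ⟨-, hn⟩)
          · rwa [hfun _ _ _ hy hz]
          · exact (hn ⟨y, hy⟩).elim
      · rw [hσ' x h]
        constructor
        · exact fun hx => Or.inr ⟨hx, h⟩
        · rintro (⟨z, hz, -⟩ | ⟨hx, -⟩)
          · exact (h ⟨z, hz⟩).elim
          · exact hx
    rw [this]
    exact ((hm.inter (measurable_snd hB)).image_of_measurable_injOn measurable_fst
      (hinj.mono Set.inter_subset_left)).union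
      (hB.diff (hm.image_of_measurable_injOn measurable_fst hinj))
  · by_cases h : ∃ y, (x, y) ∈ Δ
    · obtain ⟨y, hy⟩ := h
      rw [hσ x y hy, hσ y x (hsymm _ _ hy)]
    · rw [hσ' x h, hσ' x h]
  · by_cases h : ∃ y, (x, y) ∈ Δ
    · obtain ⟨y, hy⟩ := h
      exact Or.inr (by rwa [hσ x y hy])
    · exact Or.inl (hσ' x h)

namespace MeasuredRelation

/-- Saturation and passage to a measurable hull alternate: the hull keeps the next saturation null
by quasi-invariance, and the union of all stages is invariant. -/
theorem exists_invariant_null_superset (R : MeasuredRelation.{u}) {N : Set R.carrier}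
    (hN : R.μ N = 0) :
    ∃ M, N ⊆ M ∧ MeasurableSet M ∧ IsInvariantSet R.rel M ∧ R.μ M = 0 := by
  let T : ℕ → Set R.carrier := fun n => Nat.rec (toMeasurable R.μ N)
    (fun _ A => toMeasurable R.μ {x | ∃ a ∈ A, R.rel x a}) n
  have hT : ∀ n, MeasurableSet (T n) := by
    rintro (_ | n) <;> exact measurableSet_toMeasurable _ _
  have hT0 : ∀ n, R.μ (T n) = 0 := by
    intro n
    induction n with
    | zero => exact (measure_toMeasurable N).trans hN
    | succ n ih => exact (measure_toMeasurable _).trans (R.quasiInvariant _ (hT n) ih)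
  refine ⟨⋃ n, T n, (subset_toMeasurable R.μ N).trans (Set.subset_iUnion T 0),
    MeasurableSet.iUnion hT, fun x y hxy hx => ?_, measure_iUnion_null hT0⟩
  obtain ⟨n, hn⟩ := Set.mem_iUnion.1 hx
  exact Set.mem_iUnion.2 ⟨n + 1, subset_toMeasurable R.μ _ ⟨x, hn, R.rel.symm hxy⟩⟩

theorem IsInvariantSet.compl {X : Type u} {S : Setoid X} {A : Set X} (hA : IsInvariantSet S A) :
    IsInvariantSet S Aᶜ :=
  fun x y hxy hx hy => hx (hA y x (S.symm hxy) hy)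

theorem exists_invariant_conull (R : MeasuredRelation.{u}) {p : R.carrier → Prop}
    (h : ∀ᵐ x ∂(R.μ), p x) :
    ∃ Y, MeasurableSet Y ∧ IsInvariantSet R.rel Y ∧ R.μ Yᶜ = 0 ∧ ∀ x ∈ Y, p x := by
  obtain ⟨M, hsub, hM, hinv, h0⟩ := R.exists_invariant_null_superset (ae_iff.1 h)
  refine ⟨Mᶜ, hM.compl, hinv.compl, by rwa [compl_compl], fun x hx => ?_⟩
  by_contra hp
  exact hx (hsub hp)

/-- Measurable involutions `σ k` with graphs contained in `R`, whose graphs cover the restriction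
of `R` to an invariant conull Borel set `Y`. -/
structure IsInvolutiveCover (R : MeasuredRelation.{u}) (σ : ℕ → R.carrier → R.carrier)
    (Y : Set R.carrier) : Prop where
  measurable : ∀ k, Measurable (σ k)
  involutive : ∀ k x, σ k (σ k x) = x
  rel : ∀ k x, R.rel x (σ k x)
  zero : ∀ x, σ 0 x = x
  measurableSet : MeasurableSet Y
  invariant : IsInvariantSet R.rel Y
  conull : R.μ Yᶜ = 0
  exists_eq : ∀ x ∈ Y, ∀ y, R.rel x y → ∃ k, σ k x = y

/-- **Feldman–Moore theorem**, up to a null set. -/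
theorem exists_isInvolutiveCover (R : MeasuredRelation.{u}) :
    ∃ σ Y, R.IsInvolutiveCover σ Y := by
  let E : Set (R.carrier × R.carrier) := {p | R.rel p.1 p.2}
  have hE : MeasurableSet E := R.measurableSet_graph
  have : StandardBorelSpace E := hE.standardBorel
  obtain ⟨G, hGm, hGi, hG⟩ := exists_countable_injOn_cover R.μ (P := E) (p := fun q => q.1.1)
    (measurable_fst.comp measurable_subtype_coe) (fun x => by
      refine Set.MapsTo.countable_of_injOn (f := fun q : E => q.1.2) ?_ ?_ (R.countable_class x)
      · rintro ⟨⟨a, b⟩, hab⟩ (rfl : a = x)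
        exact hab
      · rintro ⟨⟨a, b⟩, hab⟩ (rfl : a = x) ⟨⟨a', b'⟩, hab'⟩ (rfl : a' = a) (rfl : b = b')
        rfl)
  let g : ℕ → Set (R.carrier × R.carrier) := fun n => Subtype.val '' G n
  have hgm : ∀ n, MeasurableSet (g n) := fun n => hE.subtype_image (hGm n)
  have hgrel : ∀ n x y, (x, y) ∈ g n → R.rel x y := by
    rintro n x y ⟨⟨q, hq⟩, -, rfl⟩
    exact hq
  have hgfun : ∀ n x y z, (x, y) ∈ g n → (x, z) ∈ g n → y = z := by
    rintro n x y z ⟨q, hq, hqe⟩ ⟨q', hq', hqe'⟩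
    have : q = q' := hGi n hq hq' (by simp [hqe, hqe'])
    subst this
    exact (Prod.ext_iff.1 (hqe.symm.trans hqe')).2
  have hgcov : ∀ᵐ x ∂(R.μ), ∀ y, R.rel x y → ∃ n, (x, y) ∈ g n := by
    filter_upwards [hG] with x hx y hxy
    obtain ⟨n, hn⟩ := Set.mem_iUnion.1 (hx (show (⟨(x, y), hxy⟩ : E) ∈ _ from rfl))
    exact ⟨n, _, hn, rfl⟩
  obtain ⟨Y, hYm, hYi, hY0, hY⟩ := R.exists_invariant_conull hgcov
  obtain ⟨f, hf⟩ := exists_measurableEmbedding_real R.carrier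
  -- Membership in `g` both ways makes the graph functional in both directions. The rational
  -- separates domain from range, so adding the flipped graph still gives a partial function.
  let Δ₀ : ℕ × ℕ × ℚ → Set (R.carrier × R.carrier) := fun i =>
    {p | p ∈ g i.1 ∧ p.swap ∈ g i.2.1 ∧ f p.1 < i.2.2 ∧ (i.2.2 : ℝ) < f p.2}
  have hΔ₀ : ∀ i, MeasurableSet (Δ₀ i) := fun i =>
    (hgm _).inter ((measurable_swap (hgm _)).inter
      ((measurableSet_lt (hf.measurable.comp measurable_fst) measurable_const).inter
        (measurableSet_lt measurable_const (hf.measurable.comp measurable_snd))))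
  let Δ : ℕ × ℕ × ℚ → Set (R.carrier × R.carrier) := fun i => Δ₀ i ∪ Prod.swap ⁻¹' Δ₀ i
  have hΔfun : ∀ i x y z, (x, y) ∈ Δ i → (x, z) ∈ Δ i → y = z := by
    rintro i x y z (h | h) (h' | h')
    · exact hgfun _ _ _ _ h.1 h'.1
    · exact (lt_asymm h.2.2.1 h'.2.2.2).elim
    · exact (lt_asymm h'.2.2.1 h.2.2.2).elim
    · exact hgfun _ _ _ _ h.2.1 h'.2.1
  choose τ hτm hτi hτ hτ' using fun i => exists_measurable_involution_of_graph
    ((hΔ₀ i).union (measurable_swap (hΔ₀ i))) (fun x y h => h.symm) (hΔfun i)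
  obtain ⟨e, he⟩ := exists_surjective_nat (ℕ × ℕ × ℚ)
  -- Index `0` is kept for the identity, which handles the diagonal; the involutions `τ` are shifted
  -- by one.
  refine ⟨fun k => Nat.casesOn k id fun k => τ (e k), Y, ?_, ?_, ?_, fun _ => rfl, hYm, hYi, hY0,
    ?_⟩
  · rintro (_ | k)
    exacts [measurable_id, hτm _]
  · rintro (_ | k) x
    exacts [rfl, hτi _ _]
  · rintro (_ | k) x
    · exact R.rel.refl x
    · change R.rel x (τ (e k) x)
      rcases hτ' (e k) x with h | h | h
      · rw [h]
      · exact hgrel _ _ _ h.1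
      · exact R.rel.symm (hgrel _ _ _ h.1)
  · intro x hx y hxy
    by_cases hne : x = y
    · exact ⟨0, hne⟩
    obtain ⟨n, hn⟩ := hY x hx y hxy
    obtain ⟨m, hm⟩ := hY y (hYi x y hxy hx) x (R.rel.symm hxy)
    rcases lt_or_gt_of_ne (hf.injective.ne hne) with h | h
    · obtain ⟨q, hq, hq'⟩ := exists_rat_btwn h
      obtain ⟨k, hk⟩ := he (n, m, q)
      refine ⟨k + 1, ?_⟩
      change τ (e k) x = y
      rw [hk]
      exact hτ _ _ _ (Or.inl ⟨hn, hm, hq, hq'⟩)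
    · obtain ⟨q, hq, hq'⟩ := exists_rat_btwn h
      obtain ⟨k, hk⟩ := he (m, n, q)
      refine ⟨k + 1, ?_⟩
      change τ (e k) x = y
      rw [hk]
      exact hτ _ _ _ (Or.inr ⟨hm, hn, hq, hq'⟩)

end MeasuredRelation

/-! ### The ℓ² representation on classes of the subrelations -/

/-- A function which agrees on each piece of a countable measurable cover with a measurable
function is measurable. -/
theorem measurable_of_countable_cover {α β : Type*} [MeasurableSpace α] [MeasurableSpace β]
    {F : α → β} {A : ℕ → Set α} {G : ℕ → α → β} (hA : ∀ k, MeasurableSet (A k))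
    (hG : ∀ k, Measurable (G k)) (hcov : ∀ a, ∃ k, a ∈ A k)
    (heq : ∀ k, ∀ a ∈ A k, F a = G k a) : Measurable F := by
  intro B hB
  have : F ⁻¹' B = ⋃ k, A k ∩ G k ⁻¹' B := by
    ext a
    simp only [Set.mem_preimage, Set.mem_iUnion, Set.mem_inter_iff]
    constructor
    · intro h
      obtain ⟨k, hk⟩ := hcov a
      exact ⟨k, hk, heq k a hk ▸ h⟩
    · rintro ⟨k, hk, h⟩
      rwa [heq k a hk]
  rw [this]
  exact MeasurableSet.iUnion fun k => (hA k).inter (hG k hB)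

theorem measurable_of_hasSum {α ι : Type*} [MeasurableSpace α] [Countable ι] {F : ι → α → ℂ}
    {g : α → ℂ} (hF : ∀ i, Measurable (F i)) (h : ∀ a, HasSum (fun i => F i a) (g a)) :
    Measurable g := by
  refine measurable_of_tendsto_metrizable' (atTop : Filter (Finset ι))
    (f := fun s a => ∑ i ∈ s, F i a) (fun s => Finset.measurable_sum s fun i _ => hF i) ?_
  exact tendsto_pi_nhds.2 h

namespace MeasuredRelation

/-- The disjoint union over `n` of the quotients of `X` by the relations `S n`. -/
def classSetoid {X : Type u} (S : ℕ → Setoid X) : Setoid (ℕ × X) where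
  r p q := p.1 = q.1 ∧ S p.1 p.2 q.2
  iseqv :=
    { refl := fun p => ⟨rfl, (S p.1).refl p.2⟩
      symm := by
        rintro ⟨n, x⟩ ⟨m, y⟩ ⟨rfl : n = m, h⟩
        exact ⟨rfl, (S n).symm h⟩
      trans := by
        rintro ⟨n, x⟩ ⟨m, y⟩ ⟨l, z⟩ ⟨rfl : n = m, h⟩ ⟨rfl : n = l, h'⟩
        exact ⟨rfl, (S n).trans h h'⟩ }

/-- The `S n`-class of `x`, as a point of the disjoint union over `n` of the quotients by `S n`. -/
def classOf {X : Type u} (S : ℕ → Setoid X) (n : ℕ) (x : X) : Quotient (classSetoid S) :=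
  Quotient.mk _ (n, x)

theorem classOf_eq_iff {X : Type u} {S : ℕ → Setoid X} {n m : ℕ} {x y : X} :
    classOf S n x = classOf S m y ↔ n = m ∧ S n x y :=
  Quotient.eq (r := classSetoid S)

theorem exists_classOf_eq {X : Type u} {S : ℕ → Setoid X} (j : Quotient (classSetoid S)) :
    ∃ n x, classOf S n x = j := by
  obtain ⟨⟨n, x⟩, h⟩ := Quotient.exists_rep j
  exact ⟨n, x, h⟩

/-- Square summable functions on the disjoint union of the quotients by the `S n`. -/
abbrev ClassL2 {X : Type u} (S : ℕ → Setoid X) : Type u :=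
  lp (fun _ : Quotient (classSetoid S) => ℂ) 2

/-- Square summable functions supported on the classes contained in the `R`-class of `x`, for
`x ∈ Y`, and the zero space for `x ∉ Y`. -/
def orbitSubmodule {X : Type u} (R : Setoid X) (S : ℕ → Setoid X) (Y : Set X) (x : X) :
    Submodule ℂ (ClassL2 S) where
  -- For `x ∉ Y` the condition applies to every `y` and forces `f = 0`. Off `Y` the involutions need
  -- not enumerate the class, so the fibre is made trivial there.
  carrier := {f | ∀ n y, (x ∈ Y → ¬ R x y) → f (classOf S n y) = 0}
  add_mem' := fun {f g} hf hg n y h => by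
    rw [lp.coeFn_add, Pi.add_apply, hf n y h, hg n y h, add_zero]
  zero_mem' := fun n y _ => by simp
  smul_mem' := fun c f hf n y h => by
    rw [lp.coeFn_smul, Pi.smul_apply, hf n y h, smul_zero]

section

variable {X : Type u} {R : Setoid X} {S : ℕ → Setoid X} {Y : Set X}

theorem mem_orbitSubmodule {x : X} {f : ClassL2 S} :
    f ∈ orbitSubmodule R S Y x ↔ ∀ n y, (x ∈ Y → ¬ R x y) → f (classOf S n y) = 0 := Iff.rfl

theorem isClosed_orbitSubmodule (x : X) :
    IsClosed (orbitSubmodule R S Y x : Set (ClassL2 S)) := by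
  have : (orbitSubmodule R S Y x : Set (ClassL2 S)) =
      ⋂ n, ⋂ y, ⋂ _ : x ∈ Y → ¬ R x y, {f : ClassL2 S | f (classOf S n y) = 0} := by
    ext f
    simp only [SetLike.mem_coe, mem_orbitSubmodule, Set.mem_iInter, Set.mem_ofPred_eq]
  rw [this]
  refine isClosed_iInter fun n => isClosed_iInter fun y => isClosed_iInter fun _ => ?_
  exact isClosed_eq ((continuous_apply _).comp (lp.uniformContinuous_coe).continuous)
    continuous_const

instance (x : X) : CompleteSpace (orbitSubmodule R S Y x) :=
  (isClosed_orbitSubmodule x).completeSpace_coe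

theorem orbitSubmodule_eq (hY : IsInvariantSet R Y) {x y : X} (h : R x y) :
    orbitSubmodule R S Y y = orbitSubmodule R S Y x := by
  ext f
  have hxy : x ∈ Y ↔ y ∈ Y := ⟨hY x y h, hY y x (R.symm h)⟩
  have hR : ∀ z, R x z ↔ R y z := fun z => ⟨R.trans (R.symm h), R.trans h⟩
  simp only [mem_orbitSubmodule, hxy, hR]

open Classical in
/-- The unit vector at the `S n`-class of `y`, where `y` is equivalent to `x ∈ Y`. -/
noncomputable def orbitDelta (hS : ∀ n, S n ≤ R) (Y : Set X) (n : ℕ) (x y : X) (h : R x y) :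
    orbitSubmodule R S Y x :=
  ⟨if x ∈ Y then lp.single 2 (classOf S n y) 1 else 0, fun m z hz => by
    by_cases hx : x ∈ Y
    · rw [if_pos hx]
      refine lp.single_apply_ne 2 _ _ fun he => hz hx ?_
      exact R.trans h (R.symm (hS m (classOf_eq_iff.1 he).2))
    · simp [if_neg hx]⟩

open Classical in
theorem orbitDelta_apply (hS : ∀ n, S n ≤ R) (n : ℕ) {x y : X} (h : R x y) (m : ℕ) (z : X) :
    (orbitDelta hS Y n x y h : ClassL2 S) (classOf S m z) =
      if x ∈ Y ∧ n = m ∧ S n y z then 1 else 0 := by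
  by_cases hx : x ∈ Y
  · have : (orbitDelta hS Y n x y h : ClassL2 S) = lp.single 2 (classOf S n y) 1 := if_pos hx
    rw [this, lp.coeFn_single, Pi.single_apply]
    simp only [hx, true_and, eq_comm (a := classOf S m z), classOf_eq_iff]
  · have : (orbitDelta hS Y n x y h : ClassL2 S) = 0 := if_neg hx
    rw [this, if_neg fun h' => hx h'.1]
    rfl

theorem norm_orbitDelta (hS : ∀ n, S n ≤ R) (n : ℕ) {x y : X} (h : R x y) (hx : x ∈ Y) :
    ‖orbitDelta hS Y n x y h‖ = 1 := by
  classical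
  change ‖(orbitDelta hS Y n x y h : ClassL2 S)‖ = 1
  simp only [orbitDelta, if_pos hx]
  rw [lp.norm_single (by norm_num)]
  simp

theorem inner_orbitDelta (hS : ∀ n, S n ≤ R) (n : ℕ) {x y : X} (h : R x y)
    (f : orbitSubmodule R S Y x) :
    inner ℂ (orbitDelta hS Y n x y h) f = (f : ClassL2 S) (classOf S n y) := by
  classical
  rw [Submodule.coe_inner]
  by_cases hx : x ∈ Y
  · simp only [orbitDelta, if_pos hx]
    rw [lp.inner_single_left]
    simp
  · simp only [orbitDelta, if_neg hx, inner_zero_left]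
    exact (f.2 n y fun h' => (hx h').elim).symm

end

section

variable {R : MeasuredRelation.{u}} {S : ℕ → Setoid R.carrier} {σ : ℕ → R.carrier → R.carrier}
  {Y : Set R.carrier}

open Classical in
/-- The inner product of two functions on the classes contained in the class of `x`, computed by
an enumeration of the class of `x`. -/
theorem IsInvolutiveCover.hasSum_inner (hσ : R.IsInvolutiveCover σ Y) (x : R.carrier)
    {f : ClassL2 S} (hf : f ∈ orbitSubmodule R.rel S Y x) (g : ClassL2 S) :
    HasSum (fun i : ℕ × ℕ => if ∀ l < i.2, ¬ S i.1 (σ l x) (σ i.2 x) then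
      inner ℂ (f (classOf S i.1 (σ i.2 x))) (g (classOf S i.1 (σ i.2 x))) else 0)
      (inner ℂ f g) := by
  -- Each `S n`-class in the orbit is counted once, at the first `k` for which `σ k x` lies in it.
  let T : Set (ℕ × ℕ) := {i | ∀ l < i.2, ¬ S i.1 (σ l x) (σ i.2 x)}
  let c : T → Quotient (classSetoid S) := fun i => classOf S i.1.1 (σ i.1.2 x)
  have hc : Function.Injective c := by
    rintro ⟨⟨n, k⟩, hk⟩ ⟨⟨m, l⟩, hl⟩ h
    obtain ⟨rfl : n = m, h' : S n (σ k x) (σ l x)⟩ := classOf_eq_iff.1 h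
    have : k = l := by
      rcases lt_trichotomy k l with hkl | hkl | hkl
      · exact (hl k hkl h').elim
      · exact hkl
      · exact (hk l hkl ((S n).symm h')).elim
    subst this
    rfl
  have hsum := lp.hasSum_inner (𝕜 := ℂ) f g
  rw [← hc.hasSum_iff] at hsum
  · rw [show (fun j => inner ℂ (f j) (g j)) ∘ c =
      (fun i : ℕ × ℕ => inner ℂ (f (classOf S i.1 (σ i.2 x))) (g (classOf S i.1 (σ i.2 x)))) ∘
        ((↑) : T → ℕ × ℕ) from rfl, hasSum_subtype_iff_indicator] at hsum
    convert! hsum using 2 with i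
    simp only [Set.indicator_apply, T, Set.mem_ofPred_eq]
  · intro j hj
    obtain ⟨n, y, rfl⟩ := exists_classOf_eq j
    have : f (classOf S n y) = 0 := by
      by_contra h0
      have hxy : x ∈ Y ∧ R.rel x y := by
        by_contra hn
        exact h0 (hf n y fun hx hxy => hn ⟨hx, hxy⟩)
      have hex : ∃ k, S n (σ k x) y := by
        obtain ⟨k, hk⟩ := hσ.exists_eq x hxy.1 y hxy.2
        exact ⟨k, hk ▸ (S n).refl _⟩
      refine hj ⟨⟨(n, Nat.find hex), fun l hl h => Nat.find_min hex hl ?_⟩, ?_⟩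
      · exact (S n).trans h (Nat.find_spec hex)
      · exact classOf_eq_iff.2 ⟨rfl, Nat.find_spec hex⟩
    rw [this, inner_zero_left]

/-- The set of points `x` for which `σ k x` is the first point in its `S n`-class is measurable. -/
theorem IsInvolutiveCover.measurableSet_first (hσ : R.IsInvolutiveCover σ Y)
    (hm : ∀ n, MeasurableSet {p : R.carrier × R.carrier | S n p.1 p.2}) (n k : ℕ) :
    MeasurableSet {x | ∀ l < k, ¬ S n (σ l x) (σ k x)} := by
  have : {x | ∀ l < k, ¬ S n (σ l x) (σ k x)} =
      ⋂ l, ⋂ _ : l < k, (fun x => (σ l x, σ k x)) ⁻¹' {p | S n p.1 p.2}ᶜ := by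
    ext x
    simp
  rw [this]
  exact MeasurableSet.iInter fun l => MeasurableSet.iInter fun _ =>
    ((hσ.measurable l).prodMk (hσ.measurable k)) (hm n).compl

/-- Inner products of measurably varying functions on the classes are measurable. -/
theorem IsInvolutiveCover.measurable_inner (hσ : R.IsInvolutiveCover σ Y)
    (hm : ∀ n, MeasurableSet {p : R.carrier × R.carrier | S n p.1 p.2}) {α : Type*}
    [MeasurableSpace α] {b : α → R.carrier} (hb : Measurable b) {f g : α → ClassL2 S}
    (hfb : ∀ a, f a ∈ orbitSubmodule R.rel S Y (b a))
    (hf : ∀ n k, Measurable fun a => f a (classOf S n (σ k (b a))))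
    (hg : ∀ n k, Measurable fun a => g a (classOf S n (σ k (b a)))) :
    Measurable fun a => inner ℂ (f a) (g a) := by
  classical
  refine measurable_of_hasSum (fun i => ?_) fun a => hσ.hasSum_inner (b a) (hfb a) (g a)
  refine Measurable.ite (hb (hσ.measurableSet_first hm i.1 i.2)) ?_ measurable_const
  exact (hf i.1 i.2).inner (hg i.1 i.2)

/-- Measurability of a field of square summable functions on the classes. -/
def classSections (R : MeasuredRelation.{u}) (S : ℕ → Setoid R.carrier) (Y : Set R.carrier) :
    Set (∀ x, orbitSubmodule R.rel S Y x) :=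
  {ξ | ∀ n, Measurable fun p : {p : R.carrier × R.carrier // R.rel p.1 p.2} =>
    (ξ p.1.1 : ClassL2 S) (classOf S n p.1.2)}

theorem measurable_classSections_apply {ξ : ∀ x, orbitSubmodule R.rel S Y x}
    (hξ : ξ ∈ classSections R S Y) {α : Type*} [MeasurableSpace α] {b c : α → R.carrier}
    (hb : Measurable b) (hc : Measurable c) (hbc : ∀ a, R.rel (b a) (c a)) (n : ℕ) :
    Measurable fun a => (ξ (b a) : ClassL2 S) (classOf S n (c a)) :=
  (hξ n).comp (f := fun a => ⟨(b a, c a), hbc a⟩) (hb.prodMk hc).subtype_mk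

theorem orbitDelta_mem_classSections (hle : ∀ n, S n ≤ R.rel)
    (hm : ∀ n, MeasurableSet {p : R.carrier × R.carrier | S n p.1 p.2}) (hY : MeasurableSet Y)
    {τ : R.carrier → R.carrier} (hτ : Measurable τ) (hr : ∀ x, R.rel x (τ x)) (n : ℕ) :
    (fun x => orbitDelta hle Y n x (τ x) (hr x)) ∈ classSections R S Y := by
  classical
  intro m
  simp only [orbitDelta_apply]
  refine Measurable.ite ?_ measurable_const measurable_const
  have h1 : Measurable fun p : {p : R.carrier × R.carrier // R.rel p.1 p.2} => p.1.1 :=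
    measurable_fst.comp measurable_subtype_coe
  have h2 : Measurable fun p : {p : R.carrier × R.carrier // R.rel p.1 p.2} => p.1.2 :=
    measurable_snd.comp measurable_subtype_coe
  exact (h1 hY).inter ((MeasurableSet.const (n = m)).inter (((hτ.comp h1).prodMk h2) (hm n)))

/-- The field of Hilbert spaces of square summable functions on the classes, for the relations
`S n`, contained in the class of a point. -/
noncomputable def classField (hσ : R.IsInvolutiveCover σ Y) (hle : ∀ n, S n ≤ R.rel)
    (hm : ∀ n, MeasurableSet {p : R.carrier × R.carrier | S n p.1 p.2}) :
    HilbertField R.carrier where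
  fiber x := orbitSubmodule R.rel S Y x
  sections := classSections R S Y
  measurable_inner ξ hξ η hη :=
    hσ.measurable_inner hm measurable_id (fun x => (ξ x).2)
      (fun n k => measurable_classSections_apply hξ measurable_id (hσ.measurable k) (hσ.rel k) n)
      (fun n k => measurable_classSections_apply hη measurable_id (hσ.measurable k) (hσ.rel k) n)
  mem_sections η hη n := by
    have h1 : Measurable fun p : {p : R.carrier × R.carrier // R.rel p.1 p.2} => p.1.1 :=
      measurable_fst.comp measurable_subtype_coe
    have h2 : Measurable fun p : {p : R.carrier × R.carrier // R.rel p.1 p.2} => p.1.2 :=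
      measurable_snd.comp measurable_subtype_coe
    -- Where `σ k` sends the first point to the second, the coordinate is an inner product with a
    -- measurable delta field. Pairs whose first point is outside `Y` belong to every piece, as both
    -- sides vanish.
    refine measurable_of_countable_cover (A := fun k => {p | p.1.1 ∈ Y → σ k p.1.1 = p.1.2})
      (G := fun k p => inner ℂ (orbitDelta hle Y n p.1.1 (σ k p.1.1) (hσ.rel k _)) (η p.1.1))
      (fun k => ?_) (fun k => ?_) (fun p => ?_) fun k p hp => ?_
    · exact (h1 hσ.measurableSet).imp (measurableSet_eq_fun ((hσ.measurable k).comp h1) h2)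
    · exact (hη _ (orbitDelta_mem_classSections hle hm hσ.measurableSet (hσ.measurable k)
        (hσ.rel k) n)).comp h1
    · by_cases hp : p.1.1 ∈ Y
      · obtain ⟨k, hk⟩ := hσ.exists_eq _ hp _ p.2
        exact ⟨k, fun _ => hk⟩
      · exact ⟨0, fun h => (hp h).elim⟩
    · rw [inner_orbitDelta]
      by_cases hY : p.1.1 ∈ Y
      · rw [hp hY]
      · rw [(η p.1.1).2 _ _ fun h => (hY h).elim, (η p.1.1).2 _ _ fun h => (hY h).elim]
  exists_total := by
    refine ⟨fun i x => orbitDelta hle Y i.unpair.1 x (σ i.unpair.2 x) (hσ.rel _ x),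
      fun i => orbitDelta_mem_classSections hle hm hσ.measurableSet (hσ.measurable _) (hσ.rel _) _,
      fun x => ?_⟩
    rw [Submodule.dense_iff_topologicalClosure_eq_top, Submodule.topologicalClosure_eq_top_iff,
      Submodule.eq_bot_iff]
    intro f hf
    have hf0 : ∀ n k, (f : ClassL2 S) (classOf S n (σ k x)) = 0 := fun n k => by
      rw [← inner_orbitDelta hle n (hσ.rel k x)]
      refine (Submodule.mem_orthogonal _ _).1 hf _ (Submodule.subset_span ⟨Nat.pair n k, ?_⟩)
      simp only [Nat.unpair_pair]
    refine Subtype.ext (lp.ext (funext fun j => ?_))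
    obtain ⟨n, y, rfl⟩ := exists_classOf_eq j
    by_cases h : x ∈ Y → ¬ R.rel x y
    · exact f.2 n y h
    · push Not at h
      obtain ⟨k, rfl⟩ := hσ.exists_eq x h.1 y h.2
      exact hf0 n k

/-- The representation of `R` on the functions on the classes contained in the class of a point:
two equivalent points have the same space of functions. -/
noncomputable def classRep (hσ : R.IsInvolutiveCover σ Y) (hle : ∀ n, S n ≤ R.rel)
    (hm : ∀ n, MeasurableSet {p : R.carrier × R.carrier | S n p.1 p.2}) :
    UnitaryRep R.rel (classField hσ hle hm) where
  op x y h := LinearIsometryEquiv.ofEq (R' := ℂ) (orbitSubmodule R.rel S Y y)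
    (orbitSubmodule R.rel S Y x) (orbitSubmodule_eq hσ.invariant h)
  op_refl x h v := rfl
  op_comp x y z hxy hyz hxz v := rfl
  measurable_coeff ξ hξ η hη := by
    have h1 : Measurable fun p : {p : R.carrier × R.carrier // R.rel p.1 p.2} => p.1.1 :=
      measurable_fst.comp measurable_subtype_coe
    have h2 : Measurable fun p : {p : R.carrier × R.carrier // R.rel p.1 p.2} => p.1.2 :=
      measurable_snd.comp measurable_subtype_coe
    exact hσ.measurable_inner hm h1 (f := fun p => (η p.1.1).1) (g := fun p => (ξ p.1.2).1)
      (fun p => (η p.1.1).2)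
      (fun n k => measurable_classSections_apply hη h1 ((hσ.measurable k).comp h1)
        (fun p => hσ.rel k _) n)
      (fun n k => measurable_classSections_apply hξ h2 ((hσ.measurable k).comp h1)
        (fun p => R.rel.trans (R.rel.symm p.2) (hσ.rel k _)) n)

/-- `S n`-equivalent points have the same `S n`-class, so the delta field at that class is invariant
on the graph of `S n` with error exactly `0`. -/
theorem classRep_hasAlmostInvariantFields (hσ : R.IsInvolutiveCover σ Y)
    (hS : R.IsApproximation S) :
    R.HasAlmostInvariantFields (classRep hσ hS.le hS.measurableSet_graph) := by
  have hY : ∀ᵐ x ∂(R.μ), x ∈ Y := ae_iff.2 hσ.conull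
  refine ⟨fun n x => orbitDelta hS.le Y n x x (R.rel.refl x),
    fun n => {p | S n p.1 p.2}, fun _ => 0, fun n => ⟨?_, ?_⟩, ⟨hS.measurableSet_graph,
    fun n p hp => hS.le n hp, fun n m hnm p hp => hS.mono hnm hp, hS.exhaustive⟩,
    tendsto_const_nhds, fun n => ?_⟩
  · exact orbitDelta_mem_classSections hS.le hS.measurableSet_graph hσ.measurableSet
      measurable_id R.rel.refl n
  · filter_upwards [hY] with x hx
    exact norm_orbitDelta hS.le n _ hx
  · filter_upwards [hY] with x hx y h hxy
    have hy : y ∈ Y := hσ.invariant x y h hx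
    refine le_of_eq (norm_eq_zero.2 (sub_eq_zero.2 (Subtype.ext ?_)))
    change (orbitDelta hS.le Y n y y (R.rel.refl y) : ClassL2 S) =
      (orbitDelta hS.le Y n x x (R.rel.refl x) : ClassL2 S)
    simp only [orbitDelta, if_pos hx, if_pos hy]
    rw [classOf_eq_iff.2 ⟨rfl, (S n).symm hxy⟩]

/-- Property T yields square summable functions on the classes of the `S n` in almost every
`R`-class, depending only on the `R`-class. -/
theorem PropertyT.exists_invariant_class_function (hT : R.PropertyT) (hS : R.IsApproximation S) :
    ∃ (σ : ℕ → R.carrier → R.carrier) (Y : Set R.carrier) (ξ : R.carrier → ClassL2 S),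
      R.IsInvolutiveCover σ Y ∧ (∀ n, Measurable fun x => ξ x (classOf S n x)) ∧
      (∀ x ∈ Y, ξ x ≠ 0) ∧ (∀ x ∈ Y, ∀ y, R.rel x y → ξ y = ξ x) ∧
      ∀ x ∈ Y, ∀ n y, ξ x (classOf S n y) ≠ 0 → R.rel x y := by
  obtain ⟨σ, Y, hσ⟩ := R.exists_isInvolutiveCover
  obtain ⟨ξ, ⟨hξm, hξ1⟩, hξ⟩ := hT _ _ (classRep_hasAlmostInvariantFields hσ hS)
  obtain ⟨Y', hY'm, hY'i, hY'0, hY'⟩ := R.exists_invariant_conull (hξ1.and hξ)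
  refine ⟨σ, Y ∩ Y', fun x => (ξ x).1, ?_, fun n => ?_, fun x hx h0 => ?_, fun x hx y h => ?_,
    fun x hx n y h => ?_⟩
  · refine { hσ with
      measurableSet := hσ.measurableSet.inter hY'm
      invariant := fun x y h hx => ⟨hσ.invariant x y h hx.1, hY'i x y h hx.2⟩
      conull := ?_
      exists_eq := fun x hx => hσ.exists_eq x hx.1 }
    rw [Set.compl_inter]
    exact measure_union_null hσ.conull hY'0
  · exact measurable_classSections_apply hξm measurable_id measurable_id R.rel.refl n
  · have h1 : ‖ξ x‖ = 1 := (hY' x hx.2).1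
    have : ξ x = 0 := Subtype.ext h0
    rw [this, norm_zero] at h1
    exact zero_ne_one h1
  · exact congrArg Subtype.val ((hY' x hx.2).2 y h)
  · by_contra hn
    exact h ((ξ x).2 n y fun _ => hn)

end

end MeasuredRelation

/-! ### Coincidence on a set of positive measure -/

theorem lp.finite_setOf_lt_norm {ι : Type*} (f : lp (fun _ : ι => ℂ) 2) {c : ℝ} (hc : 0 < c) :
    {i | c < ‖f i‖}.Finite := by
  have hs : Summable fun i => ‖f i‖ ^ 2 := by
    simpa using (lp.memℓp f).summable (by norm_num)
  have h := hs.tendsto_cofinite_zero.eventually (gt_mem_nhds (pow_pos hc 2))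
  refine (Filter.eventually_cofinite.1 h).subset fun i hi => ?_
  exact not_lt.2 (pow_le_pow_left₀ hc.le (le_of_lt hi) 2)

namespace MeasuredRelation

/-- If property T holds, some term of an increasing exhaustive sequence of subrelations coincides
with the relation on an invariant set of positive measure. -/
theorem PropertyT.exists_coincide {R : MeasuredRelation.{u}} (hT : R.PropertyT)
    {S : ℕ → Setoid R.carrier} (hS : R.IsApproximation S) :
    ∃ (N : ℕ) (Ω : Set R.carrier), MeasurableSet Ω ∧ R.μ Ω ≠ 0 ∧ IsInvariantSet (S N) Ω ∧
      ∀ x ∈ Ω, ∀ y ∈ Ω, (R.rel x y ↔ S N x y) := by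
  obtain ⟨σ, Y, ξ, hσ, hξm, hξ0, hξi, hξs⟩ := hT.exists_invariant_class_function hS
  obtain ⟨Z, hZm, hZi, hZ0, hZ⟩ := R.exists_invariant_conull hS.exhaustive
  let A : ℕ × ℕ → Set R.carrier := fun i =>
    (Y ∩ Z) ∩ {x | (1 / (i.2 + 1 : ℝ)) < ‖ξ x (classOf S i.1 x)‖}
  have hAm : ∀ i, MeasurableSet (A i) := fun i =>
    (hσ.measurableSet.inter hZm).inter (measurableSet_lt measurable_const (hξm i.1).norm)
  obtain ⟨⟨n, c⟩, hA⟩ : ∃ i, R.μ (A i) ≠ 0 := by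
    by_contra! h
    -- A class where `ξ x` is nonzero has a representative `y ∼ x`, and `ξ y = ξ x`, so `y` itself
    -- lies in some `A i`.
    have hcov : (Y ∩ Z) ⊆ ⋃ i, {x | ∃ a ∈ A i, R.rel x a} := by
      intro x hx
      obtain ⟨j, hj⟩ : ∃ j, ξ x j ≠ 0 := by
        by_contra! h0
        exact hξ0 x hx.1 (lp.ext (funext h0))
      obtain ⟨n, y, rfl⟩ := exists_classOf_eq j
      have hxy := hξs x hx.1 n y hj
      rw [← hξi x hx.1 y hxy] at hj
      obtain ⟨k, hk⟩ := exists_nat_one_div_lt (norm_pos_iff.2 hj)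
      exact Set.mem_iUnion.2
        ⟨(n, k), y, ⟨⟨hσ.invariant x y hxy hx.1, hZi x y hxy hx.2⟩, hk⟩, hxy⟩
    have h0 : R.μ (Y ∩ Z) = 0 := measure_mono_null hcov
      (measure_iUnion_null fun i => R.quasiInvariant _ (hAm i) (h i))
    have h1 : R.μ (Y ∩ Z)ᶜ = 0 := by
      rw [Set.compl_inter]
      exact measure_union_null hσ.conull hZ0
    have h2 : R.μ Set.univ = 0 := by
      rw [← Set.union_compl_self (Y ∩ Z)]
      exact measure_union_null h0 h1
    simp at h2
  -- Points of `A (n, c)` which `S m` already joins to every point of `A (n, c)` in their `R`-class.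
  let B : ℕ → Set R.carrier := fun m => A (n, c) ∩ {x | ∀ k, σ k x ∈ A (n, c) → S m x (σ k x)}
  have hBm : ∀ m, MeasurableSet (B m) := by
    intro m
    refine (hAm _).inter ?_
    rw [Set.ofPred_forall]
    exact MeasurableSet.iInter fun k => (hσ.measurable k (hAm _)).imp
      ((measurable_id.prodMk (hσ.measurable k)) (hS.measurableSet_graph m))
  obtain ⟨m, hm⟩ : ∃ m, R.μ (B m) ≠ 0 := by
    by_contra! h
    refine hA (measure_mono_null (fun x hx => ?_) (measure_iUnion_null h))
    have hfin := lp.finite_setOf_lt_norm (ξ x) (c := 1 / (c + 1 : ℝ)) (by positivity)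
    have hbound : ∀ j : Quotient (classSetoid S), ∃ m,
        ∀ y, R.rel x y → classOf S n y = j → S m x y := by
      intro j
      by_cases hj : ∃ y, R.rel x y ∧ classOf S n y = j
      · obtain ⟨y, hxy, rfl⟩ := hj
        obtain ⟨m, hm⟩ := hZ x hx.1.2 y hxy
        -- Stage `m` joins `x` to one representative of the class, and stage `n` joins that
        -- representative to all the others.
        refine ⟨max m n, fun z _ hz => (S _).trans (hS.mono (le_max_left m n) hm) ?_⟩
        exact hS.mono (le_max_right m n) ((S n).symm (classOf_eq_iff.1 hz).2)
      · exact ⟨0, fun y hxy hy => (hj ⟨y, hxy, hy⟩).elim⟩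
    choose M hM using hbound
    refine Set.mem_iUnion.2 ⟨hfin.toFinset.sup M, hx, fun k hk => ?_⟩
    have hxk := hσ.rel k x
    have hmem : classOf S n (σ k x) ∈ hfin.toFinset := by
      rw [Set.Finite.mem_toFinset]
      have := hk.2
      rwa [Set.mem_ofPred_eq, hξi x hx.1.1 _ hxk] at this
    exact hS.mono (Finset.le_sup hmem) (hM _ _ hxk rfl)
  -- The witness is the `S m`-saturation of `B m`, written through the `σ k` so that it is visibly
  -- Borel.
  refine ⟨m, {x | ∃ k, σ k x ∈ B m ∧ S m x (σ k x)}, ?_, fun h0 => hm ?_, ?_, ?_⟩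
  · rw [Set.ofPred_exists]
    exact MeasurableSet.iUnion fun k => (hσ.measurable k (hBm m)).inter
      ((measurable_id.prodMk (hσ.measurable k)) (hS.measurableSet_graph m))
  · refine measure_mono_null (fun x hx => ?_) h0
    exact ⟨0, by rw [hσ.zero]; exact ⟨hx, (S m).refl x⟩⟩
  · rintro x y hxy ⟨k, hk, hxk⟩
    have hyk : S m y (σ k x) := (S m).trans ((S m).symm hxy) hxk
    have hy : y ∈ Y := hσ.invariant _ _ (R.rel.symm (hS.le m hyk)) hk.1.1.1
    obtain ⟨l, hl⟩ := hσ.exists_eq y hy _ (hS.le m hyk)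
    exact ⟨l, hl.symm ▸ hk, hl.symm ▸ hyk⟩
  · rintro x ⟨k, hk, hxk⟩ y ⟨l, hl, hyl⟩
    refine ⟨fun hxy => ?_, fun h => hS.le m h⟩
    obtain ⟨i, hi⟩ := hσ.exists_eq _ hk.1.1.1 (σ l y)
      (R.rel.trans (R.rel.symm (hσ.rel k x)) (R.rel.trans hxy (hσ.rel l y)))
    have h := hk.2 i (by rw [hi]; exact hl.1)
    rw [hi] at h
    exact (S m).trans hxk ((S m).trans h ((S m).symm hyl))

/-- If property T holds, an increasing exhaustive sequence of ergodic subrelations is eventually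
constant. -/
theorem PropertyT.exists_aePair_of_isErgodicFor {R : MeasuredRelation.{u}} (hT : R.PropertyT)
    {S : ℕ → Setoid R.carrier} (hS : R.IsApproximation S) (hE : ∀ n, R.IsErgodicFor (S n)) :
    ∃ N : ℕ, ∀ n ≥ N, R.AEPair fun x y _ => S n x y := by
  obtain ⟨N, Ω, hΩm, hΩ0, hΩi, hΩ⟩ := hT.exists_coincide hS
  obtain ⟨Y, -, hYi, hY0, hY⟩ := R.exists_invariant_conull
    (ae_iff.2 ((hE N Ω hΩm hΩi).resolve_left hΩ0) : ∀ᵐ x ∂(R.μ), x ∈ Ω)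
  refine ⟨N, fun n hn => ?_⟩
  filter_upwards [(ae_iff.2 hY0 : ∀ᵐ x ∂(R.μ), x ∈ Y)] with x hx y hxy
  exact hS.mono hn ((hΩ x (hY x hx) y (hY y (hYi x y hxy hx))).1 hxy)

/-! ### Finite generation from the involutions -/

/-- The equivalence relation generated by the graphs of the first `n` maps of a sequence. -/
def generatedSetoid {X : Type u} (σ : ℕ → X → X) (n : ℕ) : Setoid X :=
  Relation.EqvGen.setoid fun a b => ∃ k < n, σ k a = b

theorem foldl_reverse_of_involutive {X : Type u} {σ : ℕ → X → X} (h : ∀ k x, σ k (σ k x) = x)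
    (w : List ℕ) (x : X) :
    w.reverse.foldl (fun z k => σ k z) (w.foldl (fun z k => σ k z) x) = x := by
  induction w generalizing x with
  | nil => rfl
  | cons k w ih =>
    rw [List.foldl_cons, List.reverse_cons, List.foldl_append, ih]
    exact h k x

/-- Words in the involutions present the generated relation as a countable union of graphs of
measurable maps, which makes it Borel; reversing a word inverts it. -/
theorem generatedSetoid_iff {X : Type u} {σ : ℕ → X → X} (h : ∀ k x, σ k (σ k x) = x) {n : ℕ}
    {x y : X} : generatedSetoid σ n x y ↔
      ∃ w : List ℕ, (∀ k ∈ w, k < n) ∧ w.foldl (fun z k => σ k z) x = y := by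
  constructor
  · intro hxy
    change Relation.EqvGen _ x y at hxy
    induction hxy with
    | rel x y hxy =>
      obtain ⟨k, hk, rfl⟩ := hxy
      exact ⟨[k], by simpa using hk, rfl⟩
    | refl x => exact ⟨[], by simp, rfl⟩
    | symm x y _ ih =>
      obtain ⟨w, hw, rfl⟩ := ih
      exact ⟨w.reverse, by simpa using hw, foldl_reverse_of_involutive h w x⟩
    | trans x y z _ _ ih ih' =>
      obtain ⟨w, hw, rfl⟩ := ih
      obtain ⟨w', hw', rfl⟩ := ih'
      refine ⟨w ++ w', fun k hk => ?_, List.foldl_append⟩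
      exact (List.mem_append.1 hk).elim (hw k) (hw' k)
  · rintro ⟨w, hw, rfl⟩
    induction w generalizing x with
    | nil => exact (generatedSetoid σ n).refl x
    | cons k w ih =>
      refine (generatedSetoid σ n).trans (b := σ k x) ?_
        (ih fun l hl => hw l (List.mem_cons_of_mem k hl))
      exact Relation.EqvGen.rel _ _ ⟨k, hw k List.mem_cons_self, rfl⟩

variable {R : MeasuredRelation.{u}} {σ : ℕ → R.carrier → R.carrier} {Y : Set R.carrier}

/-- The subrelations generated by finitely many of the involutions of a cover. -/
theorem IsInvolutiveCover.isApproximation (hσ : R.IsInvolutiveCover σ Y) :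
    R.IsApproximation (generatedSetoid σ) where
  measurableSet_graph n := by
    have hw : ∀ w : List ℕ, Measurable fun x => w.foldl (fun z k => σ k z) x := by
      intro w
      induction w with
      | nil => exact measurable_id
      | cons k w ih => exact ih.comp (hσ.measurable k)
    simp only [generatedSetoid_iff hσ.involutive]
    rw [Set.ofPred_exists]
    exact MeasurableSet.iUnion fun w => (MeasurableSet.const _).inter
      (measurableSet_eq_fun ((hw w).comp measurable_fst) measurable_snd)
  le n := by
    refine Setoid.eqvGen_le ?_
    rintro x y ⟨k, -, rfl⟩
    exact hσ.rel k x
  mono n m hnm x y h := by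
    refine Relation.EqvGen.mono ?_ _ _ h
    rintro a b ⟨k, hk, hab⟩
    exact ⟨k, hk.trans_le hnm, hab⟩
  exhaustive := by
    filter_upwards [(ae_iff.2 hσ.conull : ∀ᵐ x ∂(R.μ), x ∈ Y)] with x hx y hxy
    obtain ⟨k, hk⟩ := hσ.exists_eq x hx y hxy
    exact ⟨k + 1, Relation.EqvGen.rel _ _ ⟨k, k.lt_succ_self, hk⟩⟩

/-- The partial isomorphism defined by a measurable map which is injective on a measurable set. -/
noncomputable def PartialIso.ofInjOn {D : Set R.carrier} (hD : MeasurableSet D)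
    {τ : R.carrier → R.carrier} (hτ : Measurable τ) (hinj : Set.InjOn τ D)
    (hrel : ∀ x ∈ D, R.rel x (τ x)) : R.PartialIso :=
  haveI := hD.standardBorel
  have he : MeasurableEmbedding (D.domRestrict τ) :=
    (hτ.comp measurable_subtype_coe).measurableEmbedding (Set.injOn_iff_injective.1 hinj)
  { source := D
    target := Set.range (D.domRestrict τ)
    measurableSet_source := hD
    measurableSet_target := he.measurableSet_range
    toEquiv := he.equivRange
    rel_apply := fun a => by
      rw [MeasurableEmbedding.equivRange_apply]
      exact hrel a a.2 }

theorem finitelyGenerated_of_injOn {k : ℕ} {D : Fin k → Set R.carrier}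
    {τ : Fin k → R.carrier → R.carrier} (hD : ∀ i, MeasurableSet (D i))
    (hτ : ∀ i, Measurable (τ i)) (hinj : ∀ i, Set.InjOn (τ i) (D i))
    (hrel : ∀ i, ∀ x ∈ D i, R.rel x (τ i x))
    (h : R.AEPair fun x y _ => Relation.EqvGen (fun a b => ∃ i, a ∈ D i ∧ τ i a = b) x y) :
    R.FinitelyGenerated := by
  refine ⟨k, fun i => PartialIso.ofInjOn (hD i) (hτ i) (hinj i) (hrel i), ?_⟩
  filter_upwards [h] with x hx y hxy
  refine Relation.EqvGen.mono ?_ _ _ (hx y hxy)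
  rintro a b ⟨i, ha, rfl⟩
  exact ⟨i, ha, congrArg Subtype.val (MeasurableEmbedding.equivRange_apply _ _)⟩

/-- A measurable set meeting almost every class is reached from almost every point by iterating a
single injective partial map with graph contained in the relation. -/
theorem IsInvolutiveCover.exists_injOn_eqvGen (hσ : R.IsInvolutiveCover σ Y) {Ω W : Set R.carrier}
    (hΩ : MeasurableSet Ω) (hW : MeasurableSet W) (hWi : IsInvariantSet R.rel W)
    (hWΩ : ∀ x ∈ W, ∃ k, σ k x ∈ Ω) :
    ∃ (D : Set R.carrier) (ψ : R.carrier → R.carrier), MeasurableSet D ∧ Measurable ψ ∧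
      Set.InjOn ψ D ∧ (∀ x, R.rel x (ψ x)) ∧
      ∀ x ∈ W, ∃ y ∈ Ω, Relation.EqvGen (fun a b => a ∈ D ∧ ψ a = b) x y := by
  classical
  have hp : ∀ x, ∃ k, σ k x ∈ Ω ∨ x ∉ W := fun x => by
    by_cases hx : x ∈ W
    · exact (hWΩ x hx).imp fun k => Or.inl
    · exact ⟨0, Or.inr hx⟩
  -- On `W`, `κ x` is the first index carrying `x` into `Ω`, and `β x` below is the point reached.
  -- Since `σ 0` is the identity, `κ` vanishes on `Ω`; off `W` it is `0` by convention.
  let κ : R.carrier → ℕ := fun x => Nat.find (hp x)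
  have hκm : Measurable κ := measurable_find hp fun k => (hσ.measurable k hΩ).union hW.compl
  have hκ : ∀ x ∈ W, σ (κ x) x ∈ Ω := fun x hx =>
    (Nat.find_spec (hp x)).resolve_right (not_not.2 hx)
  have hκ0 : ∀ x ∈ Ω, κ x = 0 := fun x hx =>
    (Nat.find_eq_zero (hp x)).2 (Or.inl (by rwa [hσ.zero]))
  let β : R.carrier → R.carrier := fun x => σ (κ x) x
  have hβm : Measurable β := measurable_of_countable_cover (A := fun k => κ ⁻¹' {k}) (G := σ)
    (fun k => hκm (measurableSet_singleton k)) hσ.measurable (fun x => ⟨κ x, rfl⟩)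
    (fun k x (hx : κ x = k) => by simp only [β, hx])
  -- A point is recovered from `β x` and its level `κ x` by `x = σ (κ x) (β x)`. So a fibre of `β`
  -- is a chain ordered by level, with occupied levels those `l` satisfying `κ (σ l (β x)) = l`, and
  -- `ψ` moves each point of `W` at positive level down to the next occupied one.
  let P : R.carrier → ℕ → Prop := fun x l => l < κ x ∧ κ (σ l (β x)) = l
  have hPm : ∀ l, MeasurableSet {x | P x l} := fun l =>
    (measurableSet_lt measurable_const hκm).inter
      ((hκm.comp ((hσ.measurable l).comp hβm)) (measurableSet_singleton l))
  let ρ : R.carrier → ℕ := fun x => Nat.findGreatest (P x) (κ x)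
  let ψ : R.carrier → R.carrier := fun x => σ (ρ x) (β x)
  have hρm : Measurable ρ := measurable_of_countable_cover (A := fun k => κ ⁻¹' {k})
    (G := fun k x => Nat.findGreatest (P x) k) (fun k => hκm (measurableSet_singleton k))
    (fun k => measurable_findGreatest fun l _ => hPm l) (fun x => ⟨κ x, rfl⟩)
    (fun k x (hx : κ x = k) => by simp only [ρ, hx])
  have hψm : Measurable ψ := measurable_of_countable_cover (A := fun k => ρ ⁻¹' {k})
    (G := fun k x => σ k (β x)) (fun k => hρm (measurableSet_singleton k))
    (fun k => (hσ.measurable k).comp hβm) (fun x => ⟨ρ x, rfl⟩)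
    (fun k x (hx : ρ x = k) => by simp only [ψ, hx])
  have hψr : ∀ x, R.rel x (ψ x) := fun x => R.rel.trans (hσ.rel _ x) (hσ.rel _ _)
  have hψκ : ∀ x ∈ W, 0 < κ x → ρ x < κ x ∧ κ (ψ x) = ρ x := fun x hx h0 => by
    refine Nat.findGreatest_spec (P := P x) (Nat.zero_le _) ⟨h0, ?_⟩
    rw [hσ.zero]
    exact hκ0 _ (hκ x hx)
  have hψβ : ∀ x ∈ W, 0 < κ x → β (ψ x) = β x := fun x hx h0 => by
    change σ (κ (ψ x)) (ψ x) = β x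
    rw [(hψκ x hx h0).2]
    exact hσ.involutive _ _
  -- If `κ x < κ x'`, then `κ x` would be an occupied level strictly between `ρ x'` and `κ x'`,
  -- against the maximality of `ρ x'`.
  have hle : ∀ x ∈ W, ∀ x' ∈ W, 0 < κ x → 0 < κ x' → ψ x = ψ x' → κ x' ≤ κ x := by
    intro x hx x' hx' h0 h0' h
    by_contra! hlt
    have hβ : β x = β x' := by rw [← hψβ x hx h0, ← hψβ x' hx' h0', h]
    have hρ : ρ x = ρ x' := by rw [← (hψκ x hx h0).2, ← (hψκ x' hx' h0').2, h]
    refine Nat.findGreatest_is_greatest (P := P x') (k := κ x) ?_ hlt.le ⟨hlt, ?_⟩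
    · exact lt_of_eq_of_lt hρ.symm (hψκ x hx h0).1
    · rw [← hβ]
      exact congrArg κ (hσ.involutive _ _)
  refine ⟨W ∩ {x | 0 < κ x}, ψ, hW.inter (measurableSet_lt measurable_const hκm), hψm, ?_, hψr, ?_⟩
  · rintro x ⟨hx, h0⟩ x' ⟨hx', h0'⟩ h
    have hκe : κ x = κ x' := le_antisymm (hle x' hx' x hx h0' h0 h.symm) (hle x hx x' hx' h0 h0' h)
    have hβ : β x = β x' := by rw [← hψβ x hx h0, ← hψβ x' hx' h0', h]
    rw [← hσ.involutive (κ x) x, ← hσ.involutive (κ x') x']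
    change σ (κ x) (β x) = σ (κ x') (β x')
    rw [hβ, hκe]
  · intro x hx
    obtain ⟨n, hn⟩ : ∃ n, κ x = n := ⟨_, rfl⟩
    induction n using Nat.strong_induction_on generalizing x with
    | _ n ih =>
      rcases Nat.eq_zero_or_pos (κ x) with h0 | h0
      · have := hκ x hx
        rw [h0, hσ.zero] at this
        exact ⟨x, this, Relation.EqvGen.refl x⟩
      · obtain ⟨h1, h2⟩ := hψκ x hx h0
        obtain ⟨y, hy, hxy⟩ := ih (κ (ψ x)) (by rw [h2, ← hn]; exact h1) (ψ x)
          (hWi x _ (hψr x) hx) rfl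
        exact ⟨y, hy, Relation.EqvGen.trans _ _ _ (Relation.EqvGen.rel _ _ ⟨⟨hx, h0⟩, rfl⟩) hxy⟩

/-- The points of an invariant conull set whose class meets a measurable set. -/
theorem IsInvolutiveCover.exists_saturation (hσ : R.IsInvolutiveCover σ Y) {A : Set R.carrier}
    (hA : MeasurableSet A) :
    MeasurableSet (Y ∩ {x | ∃ k, σ k x ∈ A}) ∧ IsInvariantSet R.rel (Y ∩ {x | ∃ k, σ k x ∈ A}) := by
  constructor
  · rw [Set.ofPred_exists]
    exact hσ.measurableSet.inter (MeasurableSet.iUnion fun k => hσ.measurable k hA)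
  · rintro x y hxy ⟨hx, k, hk⟩
    have hy := hσ.invariant x y hxy hx
    obtain ⟨l, hl⟩ := hσ.exists_eq y hy _ (R.rel.trans (R.rel.symm hxy) (hσ.rel k x))
    exact ⟨hy, l, by rwa [hl]⟩

theorem IsInvolutiveCover.measure_eq_zero (hσ : R.IsInvolutiveCover σ Y) {A : Set R.carrier}
    (h : R.μ (Y ∩ {x | ∃ k, σ k x ∈ A}) = 0) : R.μ A = 0 := by
  refine measure_mono_null (fun x hx => ?_) (measure_union_null h hσ.conull)
  by_cases hY : x ∈ Y
  · exact Or.inl ⟨hY, 0, by rwa [hσ.zero]⟩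
  · exact Or.inr hY

/-- An ergodic relation with property T is finitely generated. -/
theorem PropertyT.finitelyGenerated (hT : R.PropertyT) (hE : R.IsErgodicFor R.rel) :
    R.FinitelyGenerated := by
  classical
  obtain ⟨σ, Y, hσ⟩ := R.exists_isInvolutiveCover
  obtain ⟨N, Ω, hΩm, hΩ0, -, hΩ⟩ := hT.exists_coincide hσ.isApproximation
  obtain ⟨hWm, hWi⟩ := hσ.exists_saturation hΩm
  have hW0 := (hE _ hWm hWi).resolve_left fun h => hΩ0 (hσ.measure_eq_zero h)
  obtain ⟨D, ψ, hD, hψ, hinj, hrel, hgen⟩ := hσ.exists_injOn_eqvGen hΩm hWm hWi fun x hx => hx.2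
  -- The generators are the first `N` involutions, defined everywhere, and `ψ` on `D` in the last
  -- place.
  refine finitelyGenerated_of_injOn (k := N + 1) (D := Fin.lastCases D fun _ => Set.univ)
    (τ := Fin.lastCases ψ fun i => σ i) (fun i => ?_) (fun i => ?_) (fun i => ?_) (fun i => ?_) ?_
  · cases i using Fin.lastCases <;> simp [hD]
  · cases i using Fin.lastCases <;> simp [hψ, hσ.measurable]
  · cases i using Fin.lastCases with
    | last => simpa using hinj
    | cast i => simpa using (Function.Involutive.injective (hσ.involutive i))
  · cases i using Fin.lastCases <;> simp [hrel, hσ.rel]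
  · filter_upwards [(ae_iff.2 hW0 : ∀ᵐ x ∂(R.μ), x ∈ Y ∩ {x | ∃ k, σ k x ∈ Ω})] with x hx y hxy
    obtain ⟨x', hx', hxx'⟩ := hgen x hx
    obtain ⟨y', hy', hyy'⟩ := hgen y (hWi x y hxy hx)
    have hle : ∀ a b, Relation.EqvGen (fun a b => a ∈ D ∧ ψ a = b) a b → R.rel a b := by
      intro a b hab
      refine (Setoid.eqvGen_le (s := R.rel) ?_) hab
      rintro a b ⟨-, rfl⟩
      exact hrel a
    have hx'y' : generatedSetoid σ N x' y' := (hΩ x' hx' y' hy').1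
      (R.rel.trans (R.rel.symm (hle _ _ hxx')) (R.rel.trans hxy (hle _ _ hyy')))
    have hlast : ∀ a b, Relation.EqvGen (fun a b => a ∈ D ∧ ψ a = b) a b →
        Relation.EqvGen (fun a b => ∃ i : Fin (N + 1),
          a ∈ (Fin.lastCases D fun _ => Set.univ : Fin (N + 1) → Set R.carrier) i ∧
          (Fin.lastCases ψ fun i => σ i : Fin (N + 1) → R.carrier → R.carrier) i a = b) a b := by
      intro a b hab
      refine Relation.EqvGen.mono ?_ _ _ hab
      rintro a b ⟨ha, rfl⟩
      exact ⟨Fin.last N, by simpa using ha, by simp⟩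
    refine Relation.EqvGen.trans _ _ _ (hlast _ _ hxx') (Relation.EqvGen.trans _ _ _ ?_
      (Relation.EqvGen.symm _ _ (hlast _ _ hyy')))
    refine Relation.EqvGen.mono ?_ _ _ hx'y'
    rintro a b ⟨k, hk, rfl⟩
    refine ⟨Fin.castSucc ⟨k, hk⟩, ?_, ?_⟩
    · rw [Fin.lastCases_castSucc]
      trivial
    · rw [Fin.lastCases_castSucc]

/-! ### Ergodicity under stable isomorphism -/

theorem measure_eq_zero_of_inter {Z A : Set R.carrier} (hZ : MeasurableSet Z)
    (hcov : ∀ᵐ x ∂(R.μ), ∃ z ∈ Z, R.rel x z) (hA : MeasurableSet A) (hAi : IsInvariantSet R.rel A)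
    (h0 : R.μ (A ∩ Z) = 0) : R.μ A = 0 := by
  refine measure_mono_null (fun x hx => ?_)
    (measure_union_null (R.quasiInvariant _ (hA.inter hZ) h0) (ae_iff.1 hcov))
  by_cases h : ∃ z ∈ Z, R.rel x z
  · obtain ⟨z, hz, hxz⟩ := h
    exact Or.inl ⟨z, ⟨hAi x z hxz hx, hz⟩, hxz⟩
  · exact Or.inr h

/-- Ergodicity is invariant under stable isomorphism. -/
theorem StablyIsomorphic.isErgodicFor {R S : MeasuredRelation.{u}} (h : R.StablyIsomorphic S)
    (hE : R.IsErgodicFor R.rel) : S.IsErgodicFor S.rel := by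
  obtain ⟨Y, Z, f, hY, hZ, -, hcov, hnull, hrel⟩ := h
  obtain ⟨σ, W, hσ⟩ := R.exists_isInvolutiveCover
  have hBm : ∀ A : Set S.carrier, MeasurableSet A → MeasurableSet {b : Y | (f b : S.carrier) ∈ A} :=
    fun A hA => (measurable_subtype_coe.comp f.measurable) hA
  have key : ∀ A : Set S.carrier, MeasurableSet A → IsInvariantSet S.rel A →
      R.μ (Subtype.val '' {b : Y | (f b : S.carrier) ∈ A}) = 0 → S.μ A = 0 := by
    intro A hA hAi h0
    refine measure_eq_zero_of_inter hZ hcov hA hAi ?_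
    rw [hnull _ (hBm A hA)] at h0
    refine measure_mono_null (fun z hz => ?_) h0
    exact ⟨⟨z, hz.2⟩, ⟨f.symm ⟨z, hz.2⟩, by simpa using hz.1, by simp⟩, rfl⟩
  intro A hA hAi
  -- The part of `A` in `Z` is pulled back to `Y` and saturated under `R`, where ergodicity applies.
  -- If this saturation is conull, the pullback of `Aᶜ` misses it and is therefore null.
  obtain ⟨hCm, hCi⟩ := hσ.exists_saturation (hY.subtype_image (hBm A hA))
  refine (hE _ hCm hCi).imp (fun h => ?_) (fun h => ?_)
  · exact key A hA hAi (hσ.measure_eq_zero h)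
  · refine key Aᶜ hA.compl hAi.compl (measure_mono_null ?_ h)
    rintro _ ⟨b, hb, rfl⟩ ⟨-, k, b', hb', hbb'⟩
    refine hb (hAi _ _ ((hrel b' b).1 ?_) hb')
    rw [hbb']
    exact R.rel.symm (hσ.rel k b)

end MeasuredRelation

theorem mainTheorem10 :
    (∀ R : MeasuredRelation.{u}, R.PropertyT →
      ∀ S : ℕ → Setoid R.carrier, R.IsApproximation S →
        (∃ (N : ℕ) (Ω : Set R.carrier), MeasurableSet Ω ∧ R.μ Ω ≠ 0 ∧
          MeasuredRelation.IsInvariantSet (S N) Ω ∧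
          ∀ x ∈ Ω, ∀ y ∈ Ω, (R.rel x y ↔ S N x y)) ∧
        ((∀ n, R.IsErgodicFor (S n)) →
          ∃ N : ℕ, ∀ n ≥ N, R.AEPair fun x y _ => S n x y)) ∧
    (∀ R : MeasuredRelation.{u}, R.SingularErgodic → R.SingularPropertyT →
      R.SingularFiniteType) := by
  refine ⟨fun R hT S hS => ⟨hT.exists_coincide hS, hT.exists_aePair_of_isErgodicFor hS⟩, ?_⟩
  intro R hE hT S hRS
  exact (hT S hRS).finitelyGenerated (MeasuredRelation.StablyIsomorphic.isErgodicFor hRS hE)
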